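/- For a weakly increasing sequence of positive integers $\lambda = (\lambda_1 \le \dots \le \lambda_n)$, the Gelfand–Tsetlin polytope $\mathrm{GT}_\lambda$ is the set of all real arrays $(x_{i,j})_{1 \le j \le i \le n}$ with $x_{i,i} = \lambda_i$ for all $i$, and with $x_{i,j} \le x_{i+1,j}$ and $x_{i,j} \le x_{i,j+1}$ whenever both entries belong to the array. A combinatorial automorphism of a polytope is an automorphism of the poset of its faces ordered by inclusion; these form the group $\mathrm{Aut}(\mathrm{GT}_\lambda)$ under composition. **Theorem.** Let $a_1, a_2 \ge 2$ be integers and let $\lambda = (1^{a_1}, 2^{a_2})$ be the sequence consisting of $a_1$ ones followed by $a_2$ twos. If $a_1 = a_2 = 2$, then $$\mathrm{Aut}(\mathrm{GT}_\lambda) \cong D_4 \times \mathbb{Z}_2.$$ Otherwise, $$\mathrm{Aut}(\mathrm{GT}_\lambda) \cong D_4 \times \mathbb{Z}_2 \times \mathbb{Z}_2^{\delta_{a_1,a_2}}.$$ Here $D_4$ is the dihedral group of order $8$, $\mathbb{Z}_2$ is the cyclic group of order $2$, and $\delta_{a_1,a_2}$ is $1$ if $a_1 = a_2$ and $0$ otherwise.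 -/

import Mathlib

/-- The triangular grid `{(i, j) : j ≤ i}` with rows and columns indexed by `Fin n`
(so the index `k : Fin n` stands for `k + 1 ∈ {1, …, n}`). -/
abbrev TriIdx (n : ℕ) : Type := {p : Fin n × Fin n // p.2 ≤ p.1}

namespace TriIdx

/-- The row index `i` of `(i, j)`. -/
def row {n : ℕ} (p : TriIdx n) : Fin n := p.1.1

/-- The column index `j` of `(i, j)`. -/
def col {n : ℕ} (p : TriIdx n) : Fin n := p.1.2

/-- The diagonal position `(i, i)`. -/
def diag {n : ℕ} (i : Fin n) : TriIdx n := ⟨(i, i), le_refl i⟩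

end TriIdx

/-- The Gelfand-Tsetlin polytope of `lam = (lam_1, …, lam_n)`: all real fillings `x` of the
triangular grid with `x_{i,i} = lam_i`, `x_{i,j} ≤ x_{i+1,j}` and `x_{i,j} ≤ x_{i,j+1}`
whenever both positions lie in the grid. -/
def GTPolytope {n : ℕ} (lam : Fin n → ℕ) : Set (TriIdx n → ℝ) :=
  {x | (∀ i : Fin n, x (TriIdx.diag i) = (lam i : ℝ)) ∧
    (∀ p q : TriIdx n, (q.row : ℕ) = p.row + 1 → q.col = p.col → x p ≤ x q) ∧
    (∀ p q : TriIdx n, q.row = p.row → (q.col : ℕ) = p.col + 1 → x p ≤ x q)}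

/-- The partition `(1^{a₁}, 2^{a₂})`, written as a weakly increasing sequence. -/
def twoPartPartition (a₁ a₂ : ℕ) : Fin (a₁ + a₂) → ℕ :=
  fun i => if (i : ℕ) < a₁ then 1 else 2

/-- The nonempty faces of a convex set `P`: the sets of maximizers over `P` of linear
functionals (the zero functional gives `P` itself). They are ordered by inclusion.
The empty face is left out; adding it as a new least element would not change the
automorphism group of this poset. -/
abbrev PolytopeFace {E : Type*} [AddCommGroup E] [Module ℝ E] [TopologicalSpace E]
    (P : Set E) : Type _ :=
  {F : Set E // F.Nonempty ∧ IsExposed ℝ P F}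

/-- The combinatorial automorphism group of `P`: the order automorphisms of its face poset,
with composition as multiplication. -/
abbrev CombAut {E : Type*} [AddCommGroup E] [Module ℝ E] [TopologicalSpace E]
    (P : Set E) : Type _ :=
  PolytopeFace P ≃o PolytopeFace P

/-!
The polytope of `(1^(m+1), 2^(n+1))` is the order polytope of an `m × n` grid of unit squares with a
least and a greatest element adjoined, and its facets correspond to the edges of this Hasse diagram.
A combinatorial automorphism is determined by its action on the facets. The intersection of two
facets lies in a third one exactly when the two edges form one side of a unit square and the third
edge lies on the opposite side, so the induced permutations of the edges respect the unit squares.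

This makes them rigid. Call two edges partners if they form a side of a unit square. The edges at
`(i, k)` with `i + k = d` form a path for this relation, and opposite sides glue the path of level
`d` to the path of level `d + 1`. Hence a permutation fixing the edges of the first square fixes all
others up to exchanging the two edges at the corner `(m, n)` and the two unbounded edges. Moving the
first square back by the half turn, the exchange of the two edges at a corner and, if `m = n`, the
exchange of the coordinates, one finds that these symmetries and the exchange of the two unbounded
edges generate the whole group. The half turn and the corner exchange generate a dihedral group of
order eight, permuting the four corner edges cyclically, and the other two are commuting involutions
which are independent of it, except that for `m = n = 1` the exchange of the coordinates is already
a product of the others.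
-/

/-! ### Faces of polyhedra -/

section Transfer

open Set

variable {E E' : Type*} [AddCommGroup E] [Module ℝ E] [TopologicalSpace E]
  [AddCommGroup E'] [Module ℝ E'] [TopologicalSpace E'] [IsTopologicalAddGroup E']
  [ContinuousSMul ℝ E'] [T2Space E'] [FiniteDimensional ℝ E']

theorem isExposed_image_of_affine_inverse {P F : Set E} {P' : Set E'} (f : E → E')
    (g : E' →ᵃ[ℝ] E) (hf : MapsTo f P P') (hg : MapsTo g P' P)
    (hgf : ∀ x ∈ P, g (f x) = x) (hfg : ∀ y ∈ P', f (g y) = y) (hF : IsExposed ℝ P F) :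
    IsExposed ℝ P' (f '' F) := by
  intro hne
  obtain ⟨l, rfl⟩ := hF hne.of_image
  refine ⟨LinearMap.toContinuousLinearMap (l.toLinearMap ∘ₗ g.linear), ?_⟩
  have apply_linear (z : E') : l (g.linear z) = l (g z) - l (g 0) := by
    rw [g.decomp']
    simp
  ext y
  simp only [mem_image, mem_ofPred_eq, LinearMap.coe_toContinuousLinearMap', LinearMap.comp_apply,
    ContinuousLinearMap.coe_coe, apply_linear, sub_le_sub_iff_right]
  constructor
  · rintro ⟨x, ⟨hx, hmax⟩, rfl⟩
    exact ⟨hf hx, fun z hz => by simpa only [hgf x hx] using hmax _ (hg hz)⟩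
  · rintro ⟨hy, hmax⟩
    exact ⟨g y, ⟨hg hy, fun z hz => by simpa only [hgf z hz] using hmax _ (hf hz)⟩, hfg y hy⟩

variable [IsTopologicalAddGroup E] [ContinuousSMul ℝ E] [T2Space E] [FiniteDimensional ℝ E]

/-- The isomorphism of face posets induced by affine maps that restrict to mutually inverse
bijections between `P` and `P'`. -/
def faceIso {P : Set E} {P' : Set E'} (f : E →ᵃ[ℝ] E') (g : E' →ᵃ[ℝ] E) (hf : MapsTo f P P')
    (hg : MapsTo g P' P) (hgf : ∀ x ∈ P, g (f x) = x) (hfg : ∀ y ∈ P', f (g y) = y) :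
    PolytopeFace P ≃o PolytopeFace P' where
  toFun F := ⟨f '' F.1, F.2.1.image f, isExposed_image_of_affine_inverse f g hf hg hgf hfg F.2.2⟩
  invFun F := ⟨g '' F.1, F.2.1.image g, isExposed_image_of_affine_inverse g f hg hf hfg hgf F.2.2⟩
  left_inv F := Subtype.ext <|
    (image_image g f F.1).trans <|
      (image_congr fun x hx => hgf x (F.2.2.subset hx)).trans (image_id' _)
  right_inv F := Subtype.ext <|
    (image_image f g F.1).trans <|
      (image_congr fun y hy => hfg y (F.2.2.subset hy)).trans (image_id' _)
  map_rel_iff' {F G} := by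
    refine ⟨fun h x hx => ?_, fun h => image_mono h⟩
    obtain ⟨y, hy, hxy⟩ := h (mem_image_of_mem f hx)
    have hxy' : y = x := by
      rw [← hgf y (G.2.2.subset hy), hxy, hgf x (F.2.2.subset hx)]
    exact hxy' ▸ hy

end Transfer

section Polyhedron

open Set Topology

variable {E ι : Type*} [AddCommGroup E] [Module ℝ E]

/-- The polyhedron cut out by the inequalities `0 ≤ A e x`. -/
def polyhedron (A : ι → E →ᵃ[ℝ] ℝ) : Set E := {x | ∀ e, 0 ≤ A e x}

/-- The face of `polyhedron A` on which all inequalities indexed by `S` are tight; possibly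
empty. -/
def tightFace (A : ι → E →ᵃ[ℝ] ℝ) (S : Set ι) : Set E :=
  {x ∈ polyhedron A | ∀ e ∈ S, A e x = 0}

/-- In the polyhedron of `A`, tightness of the inequalities `e` and `f` forces tightness
of `g`. -/
def TightImp (A : ι → E →ᵃ[ℝ] ℝ) (e f g : ι) : Prop :=
  ∀ x ∈ polyhedron A, A e x = 0 → A f x = 0 → A g x = 0

/-- Every inequality defines a proper nonempty face, and none of these faces contains another.
The faces cut out by single inequalities are then pairwise distinct facets. -/
structure IsIrredundant (A : ι → E →ᵃ[ℝ] ℝ) : Prop where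
  exists_tight : ∀ e, ∃ x ∈ polyhedron A, A e x = 0
  exists_not_tight : ∀ e, ∃ x ∈ polyhedron A, A e x ≠ 0
  eq_of_tight_imp : ∀ e g, (∀ x ∈ polyhedron A, A e x = 0 → A g x = 0) → e = g

theorem convex_polyhedron (A : ι → E →ᵃ[ℝ] ℝ) : Convex ℝ (polyhedron A) := by
  have : polyhedron A = ⋂ e, A e ⁻¹' Ici 0 := by
    ext x
    simp [polyhedron]
  rw [this]
  exact convex_iInter fun e => (convex_Ici 0).affine_preimage (A e)

variable [Finite ι] {A : ι → E →ᵃ[ℝ] ℝ}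

theorem exists_mem_forall_tight {F : Set E} (hne : F.Nonempty) (hF : Convex ℝ F)
    (hsub : F ⊆ polyhedron A) : ∃ x ∈ F, ∀ e, A e x = 0 → ∀ y ∈ F, A e y = 0 := by
  classical
  have := Fintype.ofFinite ι
  suffices H : ∀ s : Finset ι, ∃ x ∈ F, ∀ e ∈ s, A e x = 0 → ∀ y ∈ F, A e y = 0 by
    obtain ⟨x, hx, h⟩ := H Finset.univ
    exact ⟨x, hx, fun e => h e (Finset.mem_univ e)⟩
  intro s
  induction s using Finset.induction_on with
  | empty => exact ⟨hne.some, hne.some_mem, by simp⟩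
  | insert e s _ ih =>
    obtain ⟨x, hx, h⟩ := ih
    by_cases he : ∀ y ∈ F, A e y = 0
    · exact ⟨x, hx, Finset.forall_mem_insert .. |>.2 ⟨fun _ => he, h⟩⟩
    push Not at he
    obtain ⟨y, hy, hne⟩ := he
    have tight_of_midpoint (e' : ι) (h0 : A e' (midpoint ℝ x y) = 0) :
        A e' x = 0 ∧ A e' y = 0 := by
      have hx0 := hsub hx e'
      have hy0 := hsub hy e'
      rw [(A e').map_midpoint, midpoint_eq_smul_add] at h0
      have : A e' x + A e' y = 0 := by simpa using h0
      constructor <;> linarith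
    exact ⟨midpoint ℝ x y, hF.midpoint_mem hx hy, Finset.forall_mem_insert .. |>.2
      ⟨fun h0 => absurd (tight_of_midpoint e h0).2 hne,
        fun e' he' h0 => h e' he' (tight_of_midpoint e' h0).1⟩⟩

theorem exists_pos_lineMap_neg_mem {x y : E} (hx : x ∈ polyhedron A)
    (hxy : ∀ e, A e x = 0 → A e y = 0) :
    ∃ ε > 0, AffineMap.lineMap x y (-ε : ℝ) ∈ polyhedron A := by
  suffices ∀ᶠ ε in 𝓝[>] (0 : ℝ), ∀ e, 0 ≤ A e (AffineMap.lineMap x y (-ε)) by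
    obtain ⟨ε, hε, hpos⟩ := (this.and self_mem_nhdsWithin).exists
    exact ⟨ε, hpos, hε⟩
  refine Filter.eventually_all.2 fun e => ?_
  simp only [AffineMap.apply_lineMap]
  rcases (hx e).eq_or_lt with h0 | h0
  · exact .of_forall fun ε => by simp [← h0, hxy e h0.symm]
  · have hc : Continuous fun ε : ℝ => AffineMap.lineMap (A e x) (A e y) (-ε) := by fun_prop
    have : ∀ᶠ ε in 𝓝 (0 : ℝ), 0 < AffineMap.lineMap (A e x) (A e y) (-ε) :=
      (hc.tendsto 0).eventually (lt_mem_nhds (by simpa using h0))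
    exact (this.filter_mono nhdsWithin_le_nhds).mono fun _ => le_of_lt

variable [TopologicalSpace E]

theorem eq_tightFace_of_isExposed {F : Set E} (hF : F.Nonempty)
    (hexp : IsExposed ℝ (polyhedron A) F) :
    F = tightFace A {e | ∀ x ∈ F, A e x = 0} := by
  refine Subset.antisymm (fun x hx => ⟨hexp.subset hx, fun e he => he x hx⟩) ?_
  rintro y ⟨hy, hyt⟩
  obtain ⟨x, hx, hxt⟩ :=
    exists_mem_forall_tight hF (hexp.convex (convex_polyhedron A)) hexp.subset
  obtain ⟨ε, hε, hz⟩ :=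
    exists_pos_lineMap_neg_mem (hexp.subset hx) fun e he => hyt e (hxt e he)
  obtain ⟨l, hl⟩ := hexp hF
  rw [hl] at hx ⊢
  -- `x` maximizes `l` and lies strictly between `y` and a point of the polyhedron.
  have hlxy : l x ≤ l y := by
    have := hx.2 _ hz
    simp only [AffineMap.lineMap_apply, vsub_eq_sub, vadd_eq_add, map_add, map_smul, map_sub,
      smul_eq_mul] at this
    nlinarith
  exact ⟨hy, fun z hz => (hx.2 z hz).trans hlxy⟩

variable [IsTopologicalAddGroup E] [ContinuousSMul ℝ E] [T2Space E] [FiniteDimensional ℝ E]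

theorem isExposed_tightFace (A : ι → E →ᵃ[ℝ] ℝ) (S : Set ι) :
    IsExposed ℝ (polyhedron A) (tightFace A S) := by
  classical
  rintro ⟨x₀, hx₀, hx₀S⟩
  let s := S.toFinite.toFinset
  have mem_s {e : ι} : e ∈ s ↔ e ∈ S := S.toFinite.mem_toFinset
  have linear_apply (z : E) :
      (∑ e ∈ s, (A e).linear) z = ∑ e ∈ s, A e z - ∑ e ∈ s, A e 0 := by
    simp only [LinearMap.sum_apply, AffineMap.decomp', Pi.sub_apply, Finset.sum_sub_distrib]
  have sum_nonneg (z : E) (hz : z ∈ polyhedron A) : 0 ≤ ∑ e ∈ s, A e z :=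
    Finset.sum_nonneg fun e _ => hz e
  have sum_eq_zero (z : E) (hz : ∀ e ∈ S, A e z = 0) : ∑ e ∈ s, A e z = 0 :=
    Finset.sum_eq_zero fun e he => hz e (mem_s.1 he)
  refine ⟨LinearMap.toContinuousLinearMap (-∑ e ∈ s, (A e).linear), ?_⟩
  ext x
  simp only [tightFace, mem_ofPred_eq, LinearMap.coe_toContinuousLinearMap', LinearMap.neg_apply,
    linear_apply, neg_le_neg_iff, sub_le_sub_iff_right]
  refine and_congr_right fun hx => ⟨fun h y hy => ?_, fun h e he => ?_⟩
  · exact (sum_eq_zero x h).trans_le (sum_nonneg y hy)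
  · have hsum : ∑ e ∈ s, A e x = 0 :=
      le_antisymm ((h x₀ hx₀).trans_eq (sum_eq_zero x₀ hx₀S)) (sum_nonneg x hx)
    exact (Finset.sum_eq_zero_iff_of_nonneg fun e _ => hx e).1 hsum e (mem_s.2 he)

namespace IsIrredundant

variable (h : IsIrredundant A)

/-- The face on which the inequality `e` is tight. -/
def facet (e : ι) : PolytopeFace (polyhedron A) :=
  ⟨tightFace A {e}, (h.exists_tight e).imp fun _ hx => ⟨hx.1, by simpa using hx.2⟩,
    isExposed_tightFace A {e}⟩

theorem le_facet_iff {G : PolytopeFace (polyhedron A)} {e : ι} :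
    G ≤ h.facet e ↔ ∀ x ∈ G.1, A e x = 0 :=
  ⟨fun hG x hx => (hG hx).2 e rfl, fun hG x hx =>
    ⟨G.2.2.subset hx, fun e' he' => by rw [mem_singleton_iff.1 he']; exact hG x hx⟩⟩

theorem le_iff {G H : PolytopeFace (polyhedron A)} :
    G ≤ H ↔ ∀ e, H ≤ h.facet e → G ≤ h.facet e := by
  refine ⟨fun hGH e he => hGH.trans he, fun hGH x hx => ?_⟩
  rw [eq_tightFace_of_isExposed H.2.1 H.2.2]
  exact ⟨G.2.2.subset hx, fun e he => h.le_facet_iff.1 (hGH e (h.le_facet_iff.2 he)) x hx⟩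

theorem eq_of_facet_le_facet {e g : ι} (hle : h.facet e ≤ h.facet g) : e = g :=
  h.eq_of_tight_imp e g fun x hx h0 => h.le_facet_iff.1 hle x ⟨hx, by simpa using h0⟩

theorem facet_injective : Function.Injective h.facet :=
  fun _ _ he => h.eq_of_facet_le_facet he.le

theorem exists_le_facet {G H : PolytopeFace (polyhedron A)} (hGH : ¬H ≤ G) :
    ∃ e, G ≤ h.facet e := by
  by_contra! hne
  exact hGH (h.le_iff.2 fun e he => absurd he (hne e))

theorem exists_not_le_facet (e : ι) : ∃ H, ¬H ≤ h.facet e := by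
  obtain ⟨x, hx, h0⟩ := h.exists_not_tight e
  exact ⟨⟨tightFace A ∅, ⟨x, hx, by simp⟩, isExposed_tightFace A ∅⟩,
    fun hle => h0 (h.le_facet_iff.1 hle x ⟨hx, by simp⟩)⟩

theorem exists_map_facet_le (φ : CombAut (polyhedron A)) (e : ι) :
    ∃ e', φ (h.facet e) ≤ h.facet e' := by
  obtain ⟨H, hH⟩ := h.exists_not_le_facet e
  exact h.exists_le_facet (H := φ H) (by simpa using hH)

theorem exists_map_facet (φ : CombAut (polyhedron A)) (e : ι) :
    ∃ e', φ (h.facet e) = h.facet e' := by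
  obtain ⟨e', he'⟩ := h.exists_map_facet_le φ e
  obtain ⟨e'', he''⟩ := h.exists_map_facet_le φ.symm e'
  obtain rfl : e = e'' := h.eq_of_facet_le_facet ((φ.le_symm_apply.2 he').trans he'')
  exact ⟨e', le_antisymm he' (φ.symm_apply_le.1 he'')⟩

/-- The action of combinatorial automorphisms on facets. -/
noncomputable def facetHom : CombAut (polyhedron A) →* Equiv.Perm ι :=
  MonoidHom.toHomPerm
    { toFun := fun φ e => (h.exists_map_facet φ e).choose
      map_one' := by
        funext e
        exact (h.facet_injective (h.exists_map_facet 1 e).choose_spec).symm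
      map_mul' := fun φ ψ => by
        funext e
        apply h.facet_injective
        rw [← (h.exists_map_facet (φ * ψ) e).choose_spec]
        change φ (ψ (h.facet e)) = h.facet (h.exists_map_facet φ
          (h.exists_map_facet ψ e).choose).choose
        rw [← (h.exists_map_facet φ _).choose_spec, ← (h.exists_map_facet ψ e).choose_spec] }

theorem map_facet (φ : CombAut (polyhedron A)) (e : ι) :
    φ (h.facet e) = h.facet (h.facetHom φ e) :=
  (h.exists_map_facet φ e).choose_spec

theorem facetHom_injective : Function.Injective h.facetHom := by
  rw [injective_iff_map_eq_one]
  intro φ hφ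
  have map_facet_eq (e : ι) : φ (h.facet e) = h.facet e := by rw [h.map_facet, hφ]; rfl
  have map_le_facet_iff (G : PolytopeFace (polyhedron A)) (e : ι) :
      φ G ≤ h.facet e ↔ G ≤ h.facet e := by
    conv_lhs => rw [← map_facet_eq e]
    exact φ.le_iff_le
  refine OrderIso.ext (funext fun G => le_antisymm ?_ ?_)
  · exact h.le_iff.2 fun e => (map_le_facet_iff G e).2
  · exact h.le_iff.2 fun e => (map_le_facet_iff G e).1

theorem tightImp_iff {e f g : ι} :
    TightImp A e f g ↔
      ∀ G : PolytopeFace (polyhedron A), G ≤ h.facet e → G ≤ h.facet f → G ≤ h.facet g := by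
  refine ⟨fun H G he hf => ?_, fun H x hx he hf => ?_⟩
  · rw [h.le_facet_iff] at *
    exact fun x hx => H x (G.2.2.subset hx) (he x hx) (hf x hx)
  · let G : PolytopeFace (polyhedron A) :=
      ⟨tightFace A {e' | A e' x = 0}, ⟨x, hx, fun _ => id⟩, isExposed_tightFace A _⟩
    exact h.le_facet_iff.1 (H G (h.le_facet_iff.2 fun y hy => hy.2 e he)
      (h.le_facet_iff.2 fun y hy => hy.2 f hf)) x ⟨hx, fun _ => id⟩

theorem tightImp_facetHom (φ : CombAut (polyhedron A)) (e f g : ι) :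
    TightImp A (h.facetHom φ e) (h.facetHom φ f) (h.facetHom φ g) ↔ TightImp A e f g := by
  rw [h.tightImp_iff, h.tightImp_iff, ← h.map_facet, ← h.map_facet, ← h.map_facet,
    φ.surjective.forall]
  simp only [φ.le_iff_le]

theorem mem_range_facetHom (f : E →ᵃ[ℝ] E) (σ : Equiv.Perm ι) (hσ : Function.Involutive σ)
    (hf : Function.Involutive f) (hfσ : ∀ e x, A e (f x) = A (σ e) x) :
    σ ∈ h.facetHom.range := by
  have hm : MapsTo f (polyhedron A) (polyhedron A) := fun x hx e => by
    rw [hfσ]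
    exact hx _
  refine ⟨faceIso f f hm hm (fun x _ => hf x) (fun x _ => hf x), Equiv.ext fun e => ?_⟩
  refine h.eq_of_facet_le_facet ?_
  rw [← h.map_facet, h.le_facet_iff]
  rintro _ ⟨x, hx, rfl⟩
  rw [hfσ, hσ]
  exact hx.2 e rfl

end IsIrredundant

end Polyhedron

/-! ### Order polytopes -/

section OrderPolytope

open Set

variable {P ι : Type*}

/-- The evaluation at `q` of the extension of `x : P → ℝ` by `x ⊥ = 0` and `x ⊤ = 1`. -/
def hatEval (q : WithBotTop P) : (P → ℝ) →ᵃ[ℝ] ℝ :=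
  q.rec (AffineMap.const ℝ _ 0) AffineMap.proj (AffineMap.const ℝ _ 1)

@[simp]
theorem hatEval_bot (x : P → ℝ) : hatEval ⊥ x = 0 := rfl

@[simp]
theorem hatEval_top (x : P → ℝ) : hatEval ⊤ x = 1 := rfl

@[simp]
theorem hatEval_coe (p : P) (x : P → ℝ) : hatEval p x = x p := rfl

/-- The increase of the extension of `x : P → ℝ` along the edge `e` from `src e` to `tgt e`. -/
def edgeSlack (src tgt : ι → WithBotTop P) (e : ι) : (P → ℝ) →ᵃ[ℝ] ℝ :=
  hatEval (tgt e) - hatEval (src e)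

theorem edgeSlack_apply (src tgt : ι → WithBotTop P) (e : ι) (x : P → ℝ) :
    edgeSlack src tgt e x = hatEval (tgt e) x - hatEval (src e) x := rfl

/-- The extension of `θ : P → P` to `WithBotTop P` that exchanges `⊥` and `⊤`. -/
def hatDual (θ : P → P) (q : WithBotTop P) : WithBotTop P :=
  q.rec ⊤ (fun p => (θ p : WithBotTop P)) ⊥

/-- The map `x ↦ 1 - x ∘ θ`, which preserves the order polytope when `θ` reverses the order. -/
def dualMap (θ : P → P) : (P → ℝ) →ᵃ[ℝ] (P → ℝ) :=
  AffineMap.pi fun p => hatEval ⊤ - hatEval (θ p)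

theorem dualMap_apply (θ : P → P) (x : P → ℝ) (p : P) : dualMap θ x p = 1 - x (θ p) := rfl

theorem hatEval_dualMap (θ : P → P) (x : P → ℝ) (q : WithBotTop P) :
    hatEval q (dualMap θ x) = 1 - hatEval (hatDual θ q) x := by
  rcases q with _ | _ | p
  · exact (sub_self (1 : ℝ)).symm
  · exact (sub_zero (1 : ℝ)).symm
  · rfl

/-- The reflection that moves the coordinate `p` to its mirror image in the interval bounded by
the coordinates `a` and `b`. -/
noncomputable def reflectMap [DecidableEq P] (p : P) (a b : WithBotTop P) : (P → ℝ) →ᵃ[ℝ] (P → ℝ) :=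
  AffineMap.pi fun q =>
    if q = p then hatEval a + hatEval b - AffineMap.proj p else AffineMap.proj q

theorem hatEval_reflectMap_self [DecidableEq P] (p : P) (a b : WithBotTop P) (x : P → ℝ) :
    hatEval (p : WithBotTop P) (reflectMap p a b x) = hatEval a x + hatEval b x - x p := by
  simp [reflectMap]

theorem hatEval_reflectMap_of_ne [DecidableEq P] {p : P} {a b q : WithBotTop P} (x : P → ℝ)
    (hq : q ≠ (p : WithBotTop P)) : hatEval q (reflectMap p a b x) = hatEval q x := by
  rcases q with _ | _ | q
  · rfl
  · rfl
  · have : q ≠ p := fun h => hq (h ▸ rfl)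
    change reflectMap p a b x q = x q
    simp [reflectMap, this]

/-- The translation along the all-ones vector that sends the coordinate `b` to one minus the
coordinate `a`, and `a` to one minus `b`. -/
def shiftMap (a b : WithBotTop P) : (P → ℝ) →ᵃ[ℝ] (P → ℝ) :=
  AffineMap.pi fun p => AffineMap.proj p + (hatEval ⊤ - hatEval a - hatEval b)

theorem hatEval_shiftMap {a b q : WithBotTop P} (x : P → ℝ) (hbot : q ≠ ⊥) (htop : q ≠ ⊤) :
    hatEval q (shiftMap a b x) = hatEval q x + (1 - hatEval a x - hatEval b x) := by
  rcases q with _ | _ | p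
  · exact absurd rfl hbot
  · exact absurd rfl htop
  · rfl

variable [PartialOrder P]

theorem not_bot_covBy_withBotTop_top [Nonempty P] : ¬(⊥ : WithBotTop P) ⋖ ⊤ := fun h => by
  obtain ⟨p⟩ := ‹Nonempty P›
  exact h.2 (bot_lt_iff_ne_bot.2 (WithBotTop.coe_ne_bot p))
    (lt_top_iff_ne_top.2 (WithBotTop.coe_ne_top p))

/-- Stanley's order polytope of `P`. -/
def orderPolytope (P : Type*) [PartialOrder P] : Set (P → ℝ) :=
  {x | Monotone x ∧ ∀ p, x p ∈ Icc (0 : ℝ) 1}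

theorem mem_orderPolytope_iff_monotone_hatEval {x : P → ℝ} :
    x ∈ orderPolytope P ↔ Monotone fun q : WithBotTop P => hatEval q x := by
  refine ⟨fun ⟨hx, hx01⟩ a b hab => ?_, fun hx => ⟨fun p q hpq => ?_, fun p => ⟨?_, ?_⟩⟩⟩
  · induction a using WithBotTop.rec with
    | bot =>
      induction b using WithBotTop.rec with
      | bot => rfl
      | coe p => simpa using (hx01 p).1
      | top => simp
    | coe p =>
      induction b using WithBotTop.rec with
      | bot => simp at hab
      | coe q => exact hx (WithBotTop.coe_le_coe.1 hab)
      | top => simpa using (hx01 p).2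
    | top => rw [top_le_iff.1 hab]
  · exact hx (WithBotTop.coe_le_coe.2 hpq)
  · exact hx (bot_le : (⊥ : WithBotTop P) ≤ (p : WithBotTop P))
  · exact hx (le_top : (p : WithBotTop P) ≤ ⊤)

/-- The `0`-`1` vector of an upper set. For `⊥ ∉ U` and `⊤ ∈ U` these are the vertices of the
order polytope. -/
noncomputable def upperSetPoint (U : UpperSet (WithBotTop P)) : P → ℝ :=
  indicator {p | (p : WithBotTop P) ∈ U} 1

/-- The edges `src e ⟶ tgt e` are the edges of the Hasse diagram of `WithBotTop P`, each listed
once. -/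
structure IsHasseDiagram (src tgt : ι → WithBotTop P) : Prop where
  covBy : ∀ e, src e ⋖ tgt e
  exists_of_covBy : ∀ {a b}, a ⋖ b → ∃ e, src e = a ∧ tgt e = b
  ext : ∀ {e f}, src e = src f → tgt e = tgt f → e = f

/-- `b` can be reached from `a` by moving up in the order and moving down along the edges
`e` and `f`. -/
def ReachesDown (src tgt : ι → WithBotTop P) (e f : ι) (a b : WithBotTop P) : Prop :=
  a ≤ b ∨ (a ≤ tgt e ∧ src e ≤ b) ∨ (a ≤ tgt f ∧ src f ≤ b) ∨
    (a ≤ tgt e ∧ src e ≤ tgt f ∧ src f ≤ b) ∨ (a ≤ tgt f ∧ src f ≤ tgt e ∧ src e ≤ b)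

section

variable {U : UpperSet (WithBotTop P)} (hbot : ⊥ ∉ U) (htop : ⊤ ∈ U)
include hbot htop

theorem hatEval_upperSetPoint (q : WithBotTop P) :
    hatEval q (upperSetPoint U) = indicator (U : Set (WithBotTop P)) 1 q := by
  classical
  induction q using WithBotTop.rec with
  | bot => simp [hbot]
  | coe p => simp [upperSetPoint, indicator_apply]
  | top => simp [htop]

theorem edgeSlack_upperSetPoint_eq_zero_iff {src tgt : ι → WithBotTop P} {e : ι} :
    edgeSlack src tgt e (upperSetPoint U) = 0 ↔ (src e ∈ U ↔ tgt e ∈ U) := by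
  classical
  rw [edgeSlack_apply, hatEval_upperSetPoint hbot htop, hatEval_upperSetPoint hbot htop]
  by_cases hs : src e ∈ U <;> by_cases ht : tgt e ∈ U <;> simp [hs, ht]

theorem upperSetPoint_mem_orderPolytope : upperSetPoint U ∈ orderPolytope P := by
  classical
  refine mem_orderPolytope_iff_monotone_hatEval.2 fun a b hab => ?_
  simp only [hatEval_upperSetPoint hbot htop]
  by_cases ha : a ∈ U
  · simp [ha, U.upper hab ha]
  · simp only [SetLike.mem_coe, ha, not_false_eq_true, indicator_of_notMem]
    exact indicator_nonneg (fun _ _ => zero_le_one) b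

end

namespace IsHasseDiagram

variable {src tgt : ι → WithBotTop P} (h : IsHasseDiagram src tgt)
include h

theorem tgt_ne_top_of_src_eq_bot [Nonempty P] {e : ι} (he : src e = ⊥) : tgt e ≠ ⊤ :=
  fun ht => not_bot_covBy_withBotTop_top (ht ▸ he ▸ h.covBy e)

theorem eq_of_le_of_le {e g : ι} (hge : tgt g ≤ tgt e) (heg : src e ≤ src g) : g = e := by
  refine h.ext ?_ ?_
  · exact (heg.eq_of_not_lt fun hlt => (h.covBy e).2 hlt ((h.covBy g).lt.trans_le hge)).symm
  · exact hge.eq_of_not_lt fun hlt => (h.covBy e).2 (heg.trans_lt (h.covBy g).lt) hlt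

variable [Finite P]

theorem polyhedron_eq_orderPolytope : polyhedron (edgeSlack src tgt) = orderPolytope P := by
  classical
  have := Fintype.ofFinite P
  let : LocallyFiniteOrder (WithBotTop P) := Fintype.toLocallyFiniteOrder
  ext x
  rw [mem_orderPolytope_iff_monotone_hatEval, monotone_iff_forall_covBy]
  refine ⟨fun hx a b hab => ?_, fun hx e => sub_nonneg.2 (hx _ _ (h.covBy e))⟩
  obtain ⟨e, rfl, rfl⟩ := h.exists_of_covBy hab
  exact sub_nonneg.1 (hx e)

theorem upperSetPoint_mem {U : UpperSet (WithBotTop P)} (hbot : ⊥ ∉ U)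
    (htop : ⊤ ∈ U) : upperSetPoint U ∈ polyhedron (edgeSlack src tgt) :=
  h.polyhedron_eq_orderPolytope ▸ upperSetPoint_mem_orderPolytope hbot htop

theorem tightImp_iff {e f g : ι} :
    TightImp (edgeSlack src tgt) e f g ↔ ReachesDown src tgt e f (tgt g) (src g) := by
  refine ⟨fun H => ?_, fun H x hx he hf => ?_⟩
  · -- The vertex of the set of all points reachable from `tgt g` is tight at `e` and `f`.
    by_contra hg
    let U : UpperSet (WithBotTop P) := ⟨{q | ReachesDown src tgt e f (tgt g) q}, by
      intro a b hab
      simp only [mem_ofPred_eq, ReachesDown]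
      grind [le_trans]⟩
    have mem_U {q : WithBotTop P} : q ∈ U ↔ ReachesDown src tgt e f (tgt g) q := Iff.rfl
    have hbot : ⊥ ∉ U := fun h0 => hg (U.upper bot_le h0)
    have htgt : tgt g ∈ U := Or.inl le_rfl
    have htop : ⊤ ∈ U := U.upper le_top htgt
    have tight_iff {e'} := edgeSlack_upperSetPoint_eq_zero_iff hbot htop
      (src := src) (tgt := tgt) (e := e')
    refine hg ((tight_iff.1 (H _ (h.upperSetPoint_mem hbot htop) (tight_iff.2 ?_)
      (tight_iff.2 ?_))).2 htgt)
    all_goals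
      refine ⟨U.upper (h.covBy _).le, ?_⟩
      simp only [mem_U, ReachesDown]
      grind [le_refl]
  · have hmono := mem_orderPolytope_iff_monotone_hatEval.1 (h.polyhedron_eq_orderPolytope ▸ hx)
    rw [edgeSlack_apply, sub_eq_zero] at he hf ⊢
    refine le_antisymm ?_ (hmono (h.covBy g).le)
    rcases H with h1 | ⟨h1, h2⟩ | ⟨h1, h2⟩ | ⟨h1, h2, h3⟩ | ⟨h1, h2, h3⟩
    · exact hmono h1
    · exact (hmono h1).trans (he.le.trans (hmono h2))
    · exact (hmono h1).trans (hf.le.trans (hmono h2))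
    · exact (hmono h1).trans (he.le.trans ((hmono h2).trans (hf.le.trans (hmono h3))))
    · exact (hmono h1).trans (hf.le.trans ((hmono h2).trans (he.le.trans (hmono h3))))

theorem tightImp_iff_eq_or {e f g : ι} :
    TightImp (edgeSlack src tgt) e f g ↔ g = e ∨ g = f ∨
      (tgt g ≤ tgt e ∧ src e ≤ tgt f ∧ src f ≤ src g) ∨
      (tgt g ≤ tgt f ∧ src f ≤ tgt e ∧ src e ≤ src g) := by
  rw [h.tightImp_iff]
  refine ⟨?_, ?_⟩
  · rintro (hg | ⟨h1, h2⟩ | ⟨h1, h2⟩ | H | H)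
    · exact absurd hg (h.covBy g).lt.not_ge
    · exact .inl (h.eq_of_le_of_le h1 h2)
    · exact .inr (.inl (h.eq_of_le_of_le h1 h2))
    · exact .inr (.inr (.inl H))
    · exact .inr (.inr (.inr H))
  · rintro (rfl | rfl | H | H)
    · exact .inr (.inl ⟨le_rfl, le_rfl⟩)
    · exact .inr (.inr (.inl ⟨le_rfl, le_rfl⟩))
    · exact .inr (.inr (.inr (.inl H)))
    · exact .inr (.inr (.inr (.inr H)))

theorem exists_edgeSlack_eq_zero [Nonempty P] (e : ι) :
    ∃ x ∈ polyhedron (edgeSlack src tgt), edgeSlack src tgt e x = 0 := by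
  by_cases he : src e = ⊥
  · let U : UpperSet (WithBotTop P) := UpperSet.Ici ⊤
    have hbot : ⊥ ∉ U := fun h0 => top_ne_bot (le_bot_iff.1 (UpperSet.mem_Ici_iff.1 h0))
    have htop : ⊤ ∈ U := UpperSet.mem_Ici_iff.2 le_rfl
    refine ⟨_, h.upperSetPoint_mem hbot htop,
      (edgeSlack_upperSetPoint_eq_zero_iff hbot htop).2 (iff_of_false (he ▸ hbot) fun h0 => ?_)⟩
    exact h.tgt_ne_top_of_src_eq_bot he (top_le_iff.1 (UpperSet.mem_Ici_iff.1 h0))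
  · let U : UpperSet (WithBotTop P) := UpperSet.Ioi ⊥
    have hbot : ⊥ ∉ U := fun h0 => lt_irrefl _ (UpperSet.mem_Ioi_iff.1 h0)
    have htop : ⊤ ∈ U := UpperSet.mem_Ioi_iff.2 bot_lt_top
    have hsrc : src e ∈ U := UpperSet.mem_Ioi_iff.2 (bot_lt_iff_ne_bot.2 he)
    exact ⟨_, h.upperSetPoint_mem hbot htop, (edgeSlack_upperSetPoint_eq_zero_iff hbot htop).2
      (iff_of_true hsrc (U.upper (h.covBy e).le hsrc))⟩

theorem exists_edgeSlack_ne_zero (e : ι) :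
    ∃ x ∈ polyhedron (edgeSlack src tgt), edgeSlack src tgt e x ≠ 0 := by
  let U : UpperSet (WithBotTop P) := UpperSet.Ici (tgt e)
  have hbot : ⊥ ∉ U := fun h0 =>
    (bot_le.trans_lt (h.covBy e).lt).ne' (le_bot_iff.1 (UpperSet.mem_Ici_iff.1 h0))
  have htop : ⊤ ∈ U := UpperSet.mem_Ici_iff.2 le_top
  refine ⟨_, h.upperSetPoint_mem hbot htop, fun h0 => (h.covBy e).lt.not_ge ?_⟩
  exact UpperSet.mem_Ici_iff.1
    (((edgeSlack_upperSetPoint_eq_zero_iff hbot htop).1 h0).2 (UpperSet.mem_Ici_iff.2 le_rfl))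

theorem eq_of_edgeSlack_imp {e g : ι} (H : ∀ x ∈ polyhedron (edgeSlack src tgt),
    edgeSlack src tgt e x = 0 → edgeSlack src tgt g x = 0) : e = g := by
  have := (h.covBy g).lt.not_ge
  have hreach := h.tightImp_iff.1 fun x hx h0 (_ : edgeSlack src tgt e x = 0) => H x hx h0
  simp only [ReachesDown] at hreach
  exact (h.eq_of_le_of_le (by tauto) (by tauto)).symm

theorem isIrredundant [Nonempty P] : IsIrredundant (edgeSlack src tgt) :=
  ⟨h.exists_edgeSlack_eq_zero, h.exists_edgeSlack_ne_zero, fun _ _ => h.eq_of_edgeSlack_imp⟩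

variable [Finite ι] [Nonempty P]

theorem dual_mem_range {θ : P → P} (hθ : Function.Involutive θ) {σ : Equiv.Perm ι}
    (hsrc : ∀ e, src (σ e) = hatDual θ (tgt e)) (htgt : ∀ e, tgt (σ e) = hatDual θ (src e)) :
    σ ∈ h.isIrredundant.facetHom.range := by
  have hhat : Function.Involutive (hatDual θ) := by
    rintro (_ | _ | p)
    · rfl
    · rfl
    · exact congrArg WithBotTop.coe (hθ p)
  refine h.isIrredundant.mem_range_facetHom (dualMap θ) σ (fun e => ?_) (fun x => ?_)
    fun e x => ?_
  · exact h.ext (by rw [hsrc, htgt, hhat]) (by rw [htgt, hsrc, hhat])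
  · ext p
    rw [dualMap_apply, dualMap_apply, hθ, sub_sub_cancel]
  · rw [edgeSlack_apply, edgeSlack_apply, hatEval_dualMap, hatEval_dualMap, hsrc, htgt]
    ring

/-- A point with a single upper cover and a single lower cover can be reflected in the interval
they bound. -/
theorem swap_mem_range_of_unique [DecidableEq ι] {p : P} {e f : ι}
    (he : ∀ g, src g = (p : WithBotTop P) ↔ g = e)
    (hf : ∀ g, tgt g = (p : WithBotTop P) ↔ g = f) :
    Equiv.swap e f ∈ h.isIrredundant.facetHom.range := by
  classical
  have hse := (he e).2 rfl
  have htf := (hf f).2 rfl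
  have hte : tgt e ≠ (p : WithBotTop P) := fun h0 => (h.covBy e).ne (hse.trans h0.symm)
  have hsf : src f ≠ (p : WithBotTop P) := fun h0 => (h.covBy f).ne (h0.trans htf.symm)
  let r := reflectMap p (src f) (tgt e)
  have hr : Function.Involutive r := fun x => by
    ext q
    change hatEval (q : WithBotTop P) (r (r x)) = _
    by_cases hq : q = p
    · subst hq
      rw [hatEval_reflectMap_self, hatEval_reflectMap_of_ne _ hsf, hatEval_reflectMap_of_ne _ hte]
      change _ - hatEval (q : WithBotTop P) (r x) = _
      rw [hatEval_reflectMap_self]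
      ring
    · have hq' : (q : WithBotTop P) ≠ (p : WithBotTop P) := WithBotTop.coe_injective.ne hq
      rw [hatEval_reflectMap_of_ne _ hq', hatEval_reflectMap_of_ne _ hq', hatEval_coe]
  refine h.isIrredundant.mem_range_facetHom r _ (Equiv.swap_apply_self e f) hr fun g x => ?_
  simp only [edgeSlack_apply]
  by_cases hge : g = e
  · rw [hge, Equiv.swap_apply_left, hse, htf, hatEval_reflectMap_self,
      hatEval_reflectMap_of_ne _ hte, hatEval_coe]
    ring
  by_cases hgf : g = f
  · rw [hgf, Equiv.swap_apply_right, hse, htf, hatEval_reflectMap_self,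
      hatEval_reflectMap_of_ne _ hsf, hatEval_coe]
    ring
  rw [Equiv.swap_apply_of_ne_of_ne hge hgf, hatEval_reflectMap_of_ne _ (mt (he g).1 hge),
    hatEval_reflectMap_of_ne _ (mt (hf g).1 hgf)]

/-- If `P` has a single minimal and a single maximal element, then a point of the order polytope
can be translated so that its distances to `0` and `1` are exchanged. -/
theorem swap_bot_top_mem_range [DecidableEq ι] {e f : ι} (he : ∀ g, src g = ⊥ ↔ g = e)
    (hf : ∀ g, tgt g = ⊤ ↔ g = f) : Equiv.swap e f ∈ h.isIrredundant.facetHom.range := by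
  have hse := (he e).2 rfl
  have htf := (hf f).2 rfl
  have hsrc_top (g : ι) : src g ≠ ⊤ := (h.covBy g).lt.ne_top
  have htgt_bot (g : ι) : tgt g ≠ ⊥ := (h.covBy g).lt.ne_bot
  have hte : tgt e ≠ ⊤ := h.tgt_ne_top_of_src_eq_bot hse
  have hsf : src f ≠ ⊥ := fun h0 => h.tgt_ne_top_of_src_eq_bot h0 htf
  let t := shiftMap (src f) (tgt e)
  have ht : Function.Involutive t := fun x => by
    ext p
    change hatEval (p : WithBotTop P) (t (t x)) = _
    rw [hatEval_shiftMap _ (by simp) (by simp), hatEval_shiftMap _ (by simp) (by simp),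
      hatEval_shiftMap _ hsf (hsrc_top f), hatEval_shiftMap _ (htgt_bot e) hte, hatEval_coe]
    ring
  refine h.isIrredundant.mem_range_facetHom t _ (Equiv.swap_apply_self e f) ht fun g x => ?_
  simp only [edgeSlack_apply]
  by_cases hge : g = e
  · rw [hge, Equiv.swap_apply_left, hse, htf, hatEval_shiftMap _ (htgt_bot e) hte, hatEval_bot,
      hatEval_top]
    ring
  by_cases hgf : g = f
  · rw [hgf, Equiv.swap_apply_right, hse, htf, hatEval_shiftMap _ hsf (hsrc_top f), hatEval_top,
      hatEval_bot]
    ring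
  rw [Equiv.swap_apply_of_ne_of_ne hge hgf, hatEval_shiftMap _ (htgt_bot g) (mt (hf g).1 hgf),
    hatEval_shiftMap _ (mt (he g).1 hge) (hsrc_top g)]
  ring

end IsHasseDiagram

end OrderPolytope

/-! ### The order polytope of a grid -/

/-- The edges of the Hasse diagrams of all grids with a least and a greatest element adjoined:
the two edges at these elements, and the horizontal and vertical grid edges at `(i, k)`. -/
inductive GridEdge : Type
  | bot | top
  | hor (i k : ℕ)
  | ver (i k : ℕ)
  deriving DecidableEq

namespace GridEdge

/-- The edge belongs to the grid with `m × n` unit squares. -/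
def Valid (m n : ℕ) : GridEdge → Prop
  | bot => True
  | top => True
  | hor i k => i < m ∧ k ≤ n
  | ver i k => i ≤ m ∧ k < n

/-- `{e, f}` is one side of a unit square of the grid with `m × n` unit squares, where the two
sides are the two paths from the least to the greatest vertex of the square, and `g` is an edge
of the other side. -/
def Opp (m n : ℕ) (e f g : GridEdge) : Prop :=
  ∃ i k, i < m ∧ k < n ∧
    ((((e = ver i k ∧ f = hor i k) ∨ (e = hor i k ∧ f = ver i k)) ∧
        (g = ver (i + 1) k ∨ g = hor i (k + 1))) ∨
      (((e = ver (i + 1) k ∧ f = hor i (k + 1)) ∨ (e = hor i (k + 1) ∧ f = ver (i + 1) k)) ∧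
        (g = ver i k ∨ g = hor i k)))

end GridEdge

open GridEdge

/-- The edges of the Hasse diagram of the grid with `m × n` unit squares. -/
abbrev Edges (m n : ℕ) : Type := {e : GridEdge // e.Valid m n}

/-- The vertices `(i, k)` of the grid with `m × n` unit squares. The order of the second
coordinate is reversed, so that the corner `(0, 0)` has one lower and one upper cover. -/
abbrev GridPt (m n : ℕ) : Type := Fin (m + 1) × (Fin (n + 1))ᵒᵈ

/-- The vertex `(i, k)` of the grid. -/
def gridPt {m n i k : ℕ} (hi : i ≤ m) (hk : k ≤ n) : GridPt m n :=
  (⟨i, Nat.lt_succ_of_le hi⟩, OrderDual.toDual ⟨k, Nat.lt_succ_of_le hk⟩)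

theorem exists_eq_gridPt {m n : ℕ} (p : GridPt m n) :
    ∃ (i k : ℕ) (hi : i ≤ m) (hk : k ≤ n), p = gridPt hi hk :=
  ⟨p.1, (OrderDual.ofDual p.2 : Fin (n + 1)), Nat.le_of_lt_succ p.1.2,
    Nat.le_of_lt_succ (OrderDual.ofDual p.2).2, rfl⟩

section

variable {m n i k j l : ℕ} {hi : i ≤ m} {hk : k ≤ n} {hj : j ≤ m} {hl : l ≤ n}

theorem gridPt_inj : gridPt hi hk = gridPt hj hl ↔ i = j ∧ k = l := by
  simp [gridPt, Prod.ext_iff]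

theorem gridPt_le_gridPt : gridPt hi hk ≤ gridPt hj hl ↔ i ≤ j ∧ l ≤ k := by
  simp [gridPt, Prod.le_def]

theorem gridPt_covBy_gridPt :
    gridPt hi hk ⋖ gridPt hj hl ↔ i + 1 = j ∧ k = l ∨ l + 1 = k ∧ i = j := by
  simp [gridPt, Prod.mk_covBy_mk_iff, Fin.covBy_iff, Order.covBy_iff_add_one_eq]

theorem isMin_gridPt : IsMin (gridPt hi hk) ↔ i = 0 ∧ k = n := by
  refine ⟨fun h => ?_, fun h p _ => ?_⟩
  · have := gridPt_le_gridPt.1 (@h (gridPt (Nat.zero_le m) le_rfl) (gridPt_le_gridPt.2 (by omega)))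
    omega
  · obtain ⟨i', k', hi', hk', rfl⟩ := exists_eq_gridPt p
    exact gridPt_le_gridPt.2 (by omega)

theorem isMax_gridPt : IsMax (gridPt hi hk) ↔ i = m ∧ k = 0 := by
  refine ⟨fun h => ?_, fun h p _ => ?_⟩
  · have := gridPt_le_gridPt.1 (@h (gridPt le_rfl (Nat.zero_le n)) (gridPt_le_gridPt.2 (by omega)))
    omega
  · obtain ⟨i', k', hi', hk', rfl⟩ := exists_eq_gridPt p
    exact gridPt_le_gridPt.2 (by omega)

end

section

variable {m n : ℕ}

instance finite_edges (m n : ℕ) : Finite (Edges m n) := by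
  have : {e : GridEdge | e.Valid m n} ⊆ {bot, top} ∪
      (Set.image2 hor (Set.Iic m) (Set.Iic n) ∪ Set.image2 ver (Set.Iic m) (Set.Iic n)) := by
    intro e he
    change e.Valid m n at he
    cases e <;> simp [Valid] at * <;> omega
  exact (Set.Finite.subset ((Set.toFinite _).union (((Set.finite_Iic m).image2 _
    (Set.finite_Iic n)).union ((Set.finite_Iic m).image2 _ (Set.finite_Iic n)))) this).to_subtype

/-- The lower end of an edge. -/
def Edges.src : Edges m n → WithBotTop (GridPt m n)
  | ⟨bot, _⟩ => ⊥
  | ⟨top, _⟩ => (gridPt le_rfl (Nat.zero_le n) : GridPt m n)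
  | ⟨hor _ _, h⟩ => (gridPt h.1.le h.2 : GridPt m n)
  | ⟨ver _ _, h⟩ => (gridPt h.1 h.2 : GridPt m n)

/-- The upper end of an edge. -/
def Edges.tgt : Edges m n → WithBotTop (GridPt m n)
  | ⟨bot, _⟩ => (gridPt (Nat.zero_le m) le_rfl : GridPt m n)
  | ⟨top, _⟩ => ⊤
  | ⟨hor _ _, h⟩ => (gridPt h.1 h.2 : GridPt m n)
  | ⟨ver _ _, h⟩ => (gridPt h.1 h.2.le : GridPt m n)

theorem withBotTop_coe_covBy_coe {P : Type*} [Preorder P] {p q : P} :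
    (p : WithBotTop P) ⋖ q ↔ p ⋖ q :=
  WithBot.coe_covBy_coe.trans WithTop.coe_covBy_coe

theorem withBotTop_bot_covBy_coe {P : Type*} [Preorder P] {p : P} :
    (⊥ : WithBotTop P) ⋖ p ↔ IsMin p :=
  WithBot.bot_covBy_coe.trans (by simp [IsMin])

theorem withBotTop_coe_covBy_top {P : Type*} [Preorder P] {p : P} :
    (p : WithBotTop P) ⋖ ⊤ ↔ IsMax p :=
  WithBot.coe_covBy_coe.trans WithTop.coe_covBy_top

theorem isHasseDiagram_grid : IsHasseDiagram (Edges.src (m := m) (n := n)) Edges.tgt where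
  covBy e := by
    rcases e with ⟨_ | _ | ⟨i, k⟩ | ⟨i, k⟩, he⟩
    · exact withBotTop_bot_covBy_coe.2 (isMin_gridPt.2 ⟨rfl, rfl⟩)
    · exact withBotTop_coe_covBy_top.2 (isMax_gridPt.2 ⟨rfl, rfl⟩)
    · exact withBotTop_coe_covBy_coe.2 (gridPt_covBy_gridPt.2 (.inl ⟨rfl, rfl⟩))
    · exact withBotTop_coe_covBy_coe.2 (gridPt_covBy_gridPt.2 (.inr ⟨rfl, rfl⟩))
  exists_of_covBy {a b} hab := by
    induction a using WithBotTop.rec with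
    | bot =>
      induction b using WithBotTop.rec with
      | bot => exact absurd hab.lt (lt_irrefl _)
      | coe p =>
        obtain ⟨i, k, hi, hk, rfl⟩ := exists_eq_gridPt p
        obtain ⟨rfl, rfl⟩ := isMin_gridPt.1 (withBotTop_bot_covBy_coe.1 hab)
        exact ⟨⟨bot, trivial⟩, rfl, rfl⟩
      | top => exact absurd hab not_bot_covBy_withBotTop_top
    | coe p =>
      obtain ⟨i, k, hi, hk, rfl⟩ := exists_eq_gridPt p
      induction b using WithBotTop.rec with
      | bot => exact absurd hab.lt not_lt_bot
      | coe q =>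
        obtain ⟨j, l, hj, hl, rfl⟩ := exists_eq_gridPt q
        obtain ⟨rfl, rfl⟩ | ⟨rfl, rfl⟩ :=
          gridPt_covBy_gridPt.1 (withBotTop_coe_covBy_coe.1 hab)
        · exact ⟨⟨hor i k, hj, hk⟩, rfl, rfl⟩
        · exact ⟨⟨ver i l, hi, hk⟩, rfl, rfl⟩
      | top =>
        obtain ⟨rfl, rfl⟩ := isMax_gridPt.1 (withBotTop_coe_covBy_top.1 hab)
        exact ⟨⟨top, trivial⟩, rfl, rfl⟩
    | top => exact absurd hab.lt not_top_lt
  ext {e f} hs ht := by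
    rcases e with ⟨_ | _ | ⟨i, k⟩ | ⟨i, k⟩, he⟩ <;>
    rcases f with ⟨_ | _ | ⟨j, l⟩ | ⟨j, l⟩, hf⟩ <;>
    simp_all [Edges.src, Edges.tgt, WithBotTop.coe_injective.eq_iff, gridPt_inj] <;>
    simp only [Valid] at hf <;>
    omega

theorem opp_comm {e f g : GridEdge} : Opp m n e f g ↔ Opp m n f e g := by
  simp only [Opp, and_comm, or_comm]

theorem opp_hor_ver {i k j l : ℕ} {g : GridEdge} : Opp m n (hor i k) (ver j l) g ↔
    i < m ∧ l < n ∧ (j = i ∧ l = k ∧ (g = ver (i + 1) k ∨ g = hor i (k + 1)) ∨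
      j = i + 1 ∧ k = l + 1 ∧ (g = ver i l ∨ g = hor i l)) := by
  simp only [Opp, GridEdge.hor.injEq, GridEdge.ver.injEq]
  grind

theorem opp_ver_hor {i k j l : ℕ} {g : GridEdge} : Opp m n (ver j l) (hor i k) g ↔
    i < m ∧ l < n ∧ (j = i ∧ l = k ∧ (g = ver (i + 1) k ∨ g = hor i (k + 1)) ∨
      j = i + 1 ∧ k = l + 1 ∧ (g = ver i l ∨ g = hor i l)) :=
  opp_comm.trans opp_hor_ver

theorem tightImp_grid_iff {e f g : Edges m n} :
    TightImp (edgeSlack Edges.src Edges.tgt) e f g ↔ g = e ∨ g = f ∨ Opp m n e.1 f.1 g.1 := by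
  rw [isHasseDiagram_grid.tightImp_iff_eq_or]
  rcases e with ⟨_ | _ | ⟨i, k⟩ | ⟨i, k⟩, he⟩ <;>
    rcases f with ⟨_ | _ | ⟨j, l⟩ | ⟨j, l⟩, hf⟩ <;>
    rcases g with ⟨_ | _ | ⟨r, s⟩ | ⟨r, s⟩, hg⟩ <;>
    simp only [opp_hor_ver, opp_ver_hor] <;>
    simp [Edges.src, Edges.tgt, gridPt_le_gridPt, Opp] <;>
    simp only [Valid] at he hf hg <;>
    omega

end

/-! ### Gelfand-Tsetlin polytopes -/

theorem TriIdx.col_le_row {N : ℕ} (p : TriIdx N) : (p.col : ℕ) ≤ p.row := p.2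

theorem TriIdx.ext_val {N : ℕ} {p q : TriIdx N} (hrow : (p.row : ℕ) = q.row)
    (hcol : (p.col : ℕ) = q.col) : p = q :=
  Subtype.ext (Prod.ext (Fin.ext hrow) (Fin.ext hcol))

namespace GTPolytope

variable {N : ℕ} {lam : Fin N → ℕ} {x : TriIdx N → ℝ} (hx : x ∈ GTPolytope lam)
include hx

theorem le_of_col_eq {p q : TriIdx N} {d : ℕ} (hrow : (q.row : ℕ) = p.row + d)
    (hcol : q.col = p.col) : x p ≤ x q := by
  induction d generalizing q with
  | zero => rw [TriIdx.ext_val hrow (congrArg Fin.val hcol)]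
  | succ d ih =>
    have := p.col_le_row
    let r : TriIdx N := ⟨(⟨p.row + d, by omega⟩, p.col), Fin.le_def.2 (by dsimp only; omega)⟩
    exact (ih (q := r) rfl rfl).trans (hx.2.1 r q hrow hcol)

theorem le_of_row_eq {p q : TriIdx N} {d : ℕ} (hrow : q.row = p.row)
    (hcol : (q.col : ℕ) = p.col + d) : x p ≤ x q := by
  induction d generalizing q with
  | zero => rw [TriIdx.ext_val (congrArg Fin.val hrow) hcol]
  | succ d ih =>
    have := q.col_le_row
    let r : TriIdx N := ⟨(p.row, ⟨p.col + d, by omega⟩), Fin.le_def.2 (by dsimp only; omega)⟩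
    exact (ih (q := r) rfl rfl).trans (hx.2.2 r q hrow hcol)

theorem le_of_le {p q : TriIdx N} (hrow : p.row ≤ q.row) (hcol : p.col ≤ q.col) : x p ≤ x q :=
  let r : TriIdx N := ⟨(q.row, p.col), hcol.trans q.2⟩
  (le_of_col_eq hx (q := r) (Nat.add_sub_of_le hrow).symm rfl).trans
    (le_of_row_eq hx (p := r) rfl (Nat.add_sub_of_le hcol).symm)

theorem lam_col_le (p : TriIdx N) : (lam p.col : ℝ) ≤ x p :=
  (hx.1 p.col).ge.trans (le_of_le hx (p := TriIdx.diag p.col) p.2 le_rfl)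

theorem le_lam_row (p : TriIdx N) : x p ≤ lam p.row :=
  (le_of_le hx (p := p) (q := TriIdx.diag p.row) le_rfl p.2).trans (hx.1 p.row).le

end GTPolytope

section GelfandTsetlin

variable {m n : ℕ}

/-- The position in the triangular array of the free entry with a given grid coordinate. -/
def triPt (p : GridPt m n) : TriIdx ((m + 1) + (n + 1)) :=
  ⟨(⟨m + 1 + n - (OrderDual.ofDual p.2 : Fin (n + 1)), by omega⟩, ⟨p.1, by omega⟩),
    Fin.le_def.2 (by dsimp only; omega)⟩

/-- The grid vertex at a position of the triangular array. The positions whose entry is forced to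
be `1` or `2` by the partition `(1^{m+1}, 2^{n+1})` are sent to `⊥` and `⊤`. -/
def triToHat (q : TriIdx ((m + 1) + (n + 1))) : WithBotTop (GridPt m n) :=
  if hrow : (q.row : ℕ) ≤ m then ⊥
  else if hcol : (q.col : ℕ) ≤ m then
    (gridPt hcol (k := m + 1 + n - q.row) (by omega) : GridPt m n)
  else ⊤

theorem triToHat_triPt (p : GridPt m n) : triToHat (triPt p) = p := by
  obtain ⟨i, k, hi, hk, rfl⟩ := exists_eq_gridPt p
  have hrow : ((triPt (gridPt hi hk)).row : ℕ) = m + 1 + n - k := rfl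
  have hcol : ((triPt (gridPt hi hk)).col : ℕ) = i := rfl
  rw [triToHat, dif_neg (by omega), dif_pos (by omega)]
  exact congrArg WithBotTop.coe (gridPt_inj.2 (by omega))

theorem triPt_eq_of_triToHat_eq {q : TriIdx ((m + 1) + (n + 1))} {p : GridPt m n}
    (h : triToHat q = p) : triPt p = q := by
  have := q.col_le_row
  obtain ⟨i, k, hi, hk, rfl⟩ := exists_eq_gridPt p
  unfold triToHat at h
  split_ifs at h with hrow hcol
  · exact absurd h.symm (WithBotTop.coe_ne_bot _)
  · have := gridPt_inj.1 (WithBotTop.coe_injective h)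
    exact TriIdx.ext_val (p := triPt _) (by change m + 1 + n - k = _; omega) this.1.symm
  · exact absurd h.symm (WithBotTop.coe_ne_top _)

theorem triToHat_eq_bot_iff {q : TriIdx ((m + 1) + (n + 1))} :
    (triToHat q : WithBotTop (GridPt m n)) = ⊥ ↔ (q.row : ℕ) ≤ m := by
  unfold triToHat
  split_ifs <;> simp_all

theorem triToHat_eq_top_iff {q : TriIdx ((m + 1) + (n + 1))} :
    (triToHat q : WithBotTop (GridPt m n)) = ⊤ ↔ m < (q.col : ℕ) := by
  have := q.col_le_row
  unfold triToHat
  split_ifs <;> simp_all; omega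

theorem triToHat_le_triToHat {p q : TriIdx ((m + 1) + (n + 1))} (hrow : (p.row : ℕ) ≤ q.row)
    (hcol : (p.col : ℕ) ≤ q.col) : (triToHat p : WithBotTop (GridPt m n)) ≤ triToHat q := by
  unfold triToHat
  split_ifs
  all_goals first
    | exact bot_le
    | exact le_top
    | exact WithBotTop.coe_le_coe.2 (gridPt_le_gridPt.2 (by omega))
    | omega

theorem triToHat_diag (i : Fin ((m + 1) + (n + 1))) :
    (triToHat (TriIdx.diag i) : WithBotTop (GridPt m n)) = if (i : ℕ) ≤ m then ⊥ else ⊤ := by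
  change (if _ : (i : ℕ) ≤ m then ⊥ else if _ : (i : ℕ) ≤ m then _ else ⊤) = _
  split_ifs <;> rfl

/-- The free entries of a triangular array, shifted to lie between `0` and `1`. -/
def gtToGrid : (TriIdx ((m + 1) + (n + 1)) → ℝ) →ᵃ[ℝ] (GridPt m n → ℝ) :=
  AffineMap.pi fun p => LinearMap.toAffineMap (LinearMap.proj (triPt p)) -
    AffineMap.const ℝ _ (1 : ℝ)

/-- The triangular array with the given free entries, shifted to lie between `1` and `2`. -/
def gridToGT : (GridPt m n → ℝ) →ᵃ[ℝ] (TriIdx ((m + 1) + (n + 1)) → ℝ) :=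
  AffineMap.pi fun q => hatEval (triToHat q) + AffineMap.const ℝ _ (1 : ℝ)

theorem gtToGrid_apply (x : TriIdx ((m + 1) + (n + 1)) → ℝ) (p : GridPt m n) :
    gtToGrid x p = x (triPt p) - 1 := rfl

theorem gridToGT_apply (y : GridPt m n → ℝ) (q : TriIdx ((m + 1) + (n + 1))) :
    gridToGT y q = hatEval (triToHat q) y + 1 := rfl

theorem one_le_twoPartPartition (a₁ a₂ : ℕ) (i : Fin (a₁ + a₂)) :
    (1 : ℝ) ≤ twoPartPartition a₁ a₂ i := by
  unfold twoPartPartition; split_ifs <;> norm_num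

theorem twoPartPartition_le_two (a₁ a₂ : ℕ) (i : Fin (a₁ + a₂)) :
    (twoPartPartition a₁ a₂ i : ℝ) ≤ 2 := by
  unfold twoPartPartition; split_ifs <;> norm_num

theorem mapsTo_gtToGrid : Set.MapsTo gtToGrid
    (GTPolytope (twoPartPartition (m + 1) (n + 1))) (orderPolytope (GridPt m n)) := by
  refine fun x hx => ⟨fun p q hpq => ?_, fun p => ⟨?_, ?_⟩⟩
  · refine sub_le_sub_right (GTPolytope.le_of_le hx (p := triPt p) (q := triPt q) ?_ hpq.1) 1
    exact Fin.le_def.2 (Nat.sub_le_sub_left (Fin.le_def.1 hpq.2) _)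
  · rw [gtToGrid_apply]
    exact sub_nonneg.2 ((one_le_twoPartPartition _ _ _).trans (GTPolytope.lam_col_le hx _))
  · rw [gtToGrid_apply]
    linarith [GTPolytope.le_lam_row hx (triPt p), twoPartPartition_le_two _ _ (triPt p).row]

theorem mapsTo_gridToGT : Set.MapsTo gridToGT (orderPolytope (GridPt m n))
    (GTPolytope (twoPartPartition (m + 1) (n + 1))) := by
  refine fun y hy => ⟨fun i => ?_, fun p q hrow hcol => ?_, fun p q hrow hcol => ?_⟩
  · rw [gridToGT_apply, triToHat_diag, twoPartPartition]
    split_ifs <;> first | omega | norm_num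
  all_goals
    have hmono := mem_orderPolytope_iff_monotone_hatEval.1 hy
    refine add_le_add_left (hmono (triToHat_le_triToHat ?_ ?_)) 1
  · omega
  · rw [hcol]
  · rw [hrow]
  · omega

theorem gridToGT_gtToGrid {x : TriIdx ((m + 1) + (n + 1)) → ℝ}
    (hx : x ∈ GTPolytope (twoPartPartition (m + 1) (n + 1))) : gridToGT (gtToGrid x) = x := by
  ext q
  have hcr := q.col_le_row
  have hlow := GTPolytope.lam_col_le hx q
  have hupp := GTPolytope.le_lam_row hx q
  simp only [twoPartPartition] at hlow hupp
  rw [gridToGT_apply]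
  induction h : (triToHat q : WithBotTop (GridPt m n)) using WithBotTop.rec with
  | bot =>
    have hrow := triToHat_eq_bot_iff.1 h
    rw [if_pos (by omega)] at hlow hupp
    norm_num at hlow hupp ⊢
    exact le_antisymm hlow hupp
  | coe p => rw [hatEval_coe, gtToGrid_apply, triPt_eq_of_triToHat_eq h, sub_add_cancel]
  | top =>
    have hcol := triToHat_eq_top_iff.1 h
    rw [if_neg (by omega)] at hlow hupp
    norm_num at hlow hupp ⊢
    exact le_antisymm hlow hupp

theorem gtToGrid_gridToGT (y : GridPt m n → ℝ) : gtToGrid (gridToGT y) = y := by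
  ext p
  rw [gtToGrid_apply, gridToGT_apply, triToHat_triPt, hatEval_coe, add_sub_cancel_right]

end GelfandTsetlin

/-- Conjugation by an order isomorphism. -/
def conjOrderIso {α β : Type*} [LE α] [LE β] (φ : α ≃o β) : (α ≃o α) ≃* (β ≃o β) where
  toFun ψ := (φ.symm.trans ψ).trans φ
  invFun ψ := (φ.trans ψ).trans φ.symm
  left_inv ψ := by ext; simp
  right_inv ψ := by ext; simp
  map_mul' ψ χ := by ext; simp

/-- The combinatorial automorphisms of the Gelfand-Tsetlin polytope of `(1^{m+1}, 2^{n+1})` are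
those of the order polytope of a grid. -/
def combAutGTEquiv (m n : ℕ) : CombAut (GTPolytope (twoPartPartition (m + 1) (n + 1))) ≃*
    CombAut (orderPolytope (GridPt m n)) :=
  conjOrderIso (faceIso gtToGrid gridToGT mapsTo_gtToGrid mapsTo_gridToGT
    (fun _ hx => gridToGT_gtToGrid hx) fun y _ => gtToGrid_gridToGT y)

/-! ### Symmetries of the grid -/

namespace GridEdge

/-- The effect on edges of the half turn of the grid. -/
def rot (m n : ℕ) : GridEdge → GridEdge
  | bot => top
  | top => bot
  | hor i k => hor (m - 1 - i) (n - k)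
  | ver i k => ver (m - i) (n - 1 - k)

/-- The effect on edges of exchanging the two coordinates, which reverses the order. -/
def flip : GridEdge → GridEdge
  | bot => top
  | top => bot
  | hor i k => ver k i
  | ver i k => hor k i

theorem Valid.rot {m n : ℕ} {e : GridEdge} (h : e.Valid m n) : (e.rot m n).Valid m n := by
  cases e <;> simp only [Valid, GridEdge.rot] at * <;> omega

theorem Valid.rot_rot {m n : ℕ} {e : GridEdge} (h : e.Valid m n) : (e.rot m n).rot m n = e := by
  cases e <;> simp only [Valid, GridEdge.rot, hor.injEq, ver.injEq] at * <;> omega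

theorem Valid.flip {m n : ℕ} {e : GridEdge} (h : e.Valid m n) : e.flip.Valid n m := by
  cases e <;> simp only [Valid, GridEdge.flip] at * <;> omega

theorem flip_flip (e : GridEdge) : e.flip.flip = e := by
  cases e <;> rfl

end GridEdge

section Symmetries

/-- The half turn as a permutation of the edges. -/
def rotPerm (m n : ℕ) : Equiv.Perm (Edges m n) :=
  Function.Involutive.toPerm (fun e => ⟨e.1.rot m n, e.2.rot⟩) fun e => Subtype.ext e.2.rot_rot

/-- Exchanging the two coordinates, on edges. -/
def flipEquiv (m n : ℕ) : Edges m n ≃ Edges n m where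
  toFun e := ⟨e.1.flip, e.2.flip⟩
  invFun e := ⟨e.1.flip, e.2.flip⟩
  left_inv e := Subtype.ext (flip_flip e.1)
  right_inv e := Subtype.ext (flip_flip e.1)

/-- Exchange of the two unbounded edges. -/
def apexSwap (m n : ℕ) : Equiv.Perm (Edges m n) := Equiv.swap ⟨bot, trivial⟩ ⟨top, trivial⟩

variable {m n : ℕ}

/-- Exchange of the two edges at the corner `(0, 0)`. -/
def cornerSwap (hm : 0 < m) (hn : 0 < n) : Equiv.Perm (Edges m n) :=
  Equiv.swap ⟨hor 0 0, hm, Nat.zero_le _⟩ ⟨ver 0 0, Nat.zero_le _, hn⟩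

/-- The half turn of the grid. -/
def gridRev (p : GridPt m n) : GridPt m n :=
  (Fin.rev p.1, OrderDual.toDual (Fin.rev (OrderDual.ofDual p.2 : Fin (n + 1))))

theorem gridRev_involutive : Function.Involutive (gridRev : GridPt m n → GridPt m n) := fun _ =>
  Prod.ext (Fin.rev_rev _) (congrArg OrderDual.toDual (Fin.rev_rev _))

theorem gridRev_gridPt {i k : ℕ} (hi : i ≤ m) (hk : k ≤ n) :
    gridRev (gridPt hi hk) = gridPt (Nat.sub_le m i) (Nat.sub_le n k) := by
  simp [gridRev, gridPt, Fin.rev]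

/-- The group of permutations of the edges induced by combinatorial automorphisms of the order
polytope of the grid. -/
noncomputable def gridAut (m n : ℕ) : Subgroup (Equiv.Perm (Edges m n)) :=
  isHasseDiagram_grid.isIrredundant.facetHom.range

theorem apexSwap_mem : apexSwap m n ∈ gridAut m n := by
  refine isHasseDiagram_grid.swap_bot_top_mem_range (fun g => ?_) fun g => ?_ <;>
    rcases g with ⟨_ | _ | _ | _, hg⟩ <;> simp [Edges.src, Edges.tgt, Subtype.ext_iff]

theorem cornerSwap_mem (hm : 0 < m) (hn : 0 < n) : cornerSwap hm hn ∈ gridAut m n := by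
  refine isHasseDiagram_grid.swap_mem_range_of_unique
    (p := gridPt (Nat.zero_le m) (Nat.zero_le n)) (fun g => ?_) fun g => ?_ <;>
    rcases g with ⟨_ | _ | _ | _, hg⟩ <;>
    simp [Edges.src, Edges.tgt, Subtype.ext_iff, gridPt_inj, WithBotTop.coe_injective.eq_iff,
      (WithBotTop.coe_ne_bot _).symm, (WithBotTop.coe_ne_top _).symm] <;>
    omega

theorem rotPerm_mem : rotPerm m n ∈ gridAut m n := by
  have rev {i k j l : ℕ} (hi : i ≤ m) (hk : k ≤ n) (hj : j ≤ m) (hl : l ≤ n)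
      (h : j = m - i ∧ l = n - k) : gridPt hj hl = gridRev (gridPt hi hk) :=
    (gridPt_inj.2 h).trans (gridRev_gridPt hi hk).symm
  refine isHasseDiagram_grid.dual_mem_range gridRev_involutive (fun e => ?_) fun e => ?_ <;>
    rcases e with ⟨_ | _ | ⟨i, k⟩ | ⟨i, k⟩, he⟩ <;> simp only [Valid] at he
  any_goals rfl
  all_goals exact congrArg WithBotTop.coe (rev _ _ _ _ (by omega))

theorem flipEquiv_mem : flipEquiv m m ∈ gridAut m m := by
  refine isHasseDiagram_grid.dual_mem_range
    (θ := fun p => (OrderDual.ofDual p.2, OrderDual.toDual p.1)) (fun p => rfl) (fun e => ?_)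
    fun e => ?_ <;>
    rcases e with ⟨_ | _ | _ | _, he⟩ <;> rfl

end Symmetries

/-! ### Rigidity of the unit squares -/

namespace GridEdge

variable {m n m' n' : ℕ} {e f g x : GridEdge}

/-- `e` and `f` are the two edges of one side of a unit square. On the edges at distance `d` from
the corner `(0, 0)` this relation is a path, in which `ver i k` has position `2 * i` and `hor i k`
has position `2 * i + 1`. -/
def Partner (m n : ℕ) (e f : GridEdge) : Prop := ∃ g, Opp m n e f g

theorem Opp.valid (h : Opp m n e f g) : e.Valid m n ∧ f.Valid m n ∧ g.Valid m n := by
  obtain ⟨i, k, hi, hk, h⟩ := h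
  rcases h with ⟨⟨rfl, rfl⟩ | ⟨rfl, rfl⟩, rfl | rfl⟩ | ⟨⟨rfl, rfl⟩ | ⟨rfl, rfl⟩, rfl | rfl⟩ <;>
    simp only [Valid] <;> omega

theorem Opp.flip (h : Opp m n e f g) : Opp n m e.flip f.flip g.flip := by
  obtain ⟨i, k, hi, hk, h⟩ := h
  refine ⟨k, i, hk, hi, ?_⟩
  rcases h with ⟨⟨rfl, rfl⟩ | ⟨rfl, rfl⟩, rfl | rfl⟩ | ⟨⟨rfl, rfl⟩ | ⟨rfl, rfl⟩, rfl | rfl⟩ <;>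
    simp [GridEdge.flip]

theorem Opp.ne (h : Opp m n e f g) : g ≠ e ∧ g ≠ f := by
  obtain ⟨i, k, -, -, h⟩ := h
  rcases h with ⟨⟨rfl, rfl⟩ | ⟨rfl, rfl⟩, rfl | rfl⟩ | ⟨⟨rfl, rfl⟩ | ⟨rfl, rfl⟩, rfl | rfl⟩ <;>
    simp

theorem partner_comm : Partner m n e f ↔ Partner m n f e :=
  exists_congr fun _ => opp_comm

theorem Partner.valid (h : Partner m n e f) : e.Valid m n ∧ f.Valid m n :=
  h.elim fun _ hg => ⟨hg.valid.1, hg.valid.2.1⟩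

theorem partner_ver_hor {i k j l : ℕ} : Partner m n (ver j l) (hor i k) ↔
    i < m ∧ l < n ∧ (j = i ∧ k = l ∨ j = i + 1 ∧ k = l + 1) := by
  simp only [Partner, opp_ver_hor]
  grind

theorem partner_hor_ver {i k j l : ℕ} : Partner m n (hor i k) (ver j l) ↔
    i < m ∧ l < n ∧ (j = i ∧ k = l ∨ j = i + 1 ∧ k = l + 1) :=
  partner_comm.trans partner_ver_hor

theorem partner_cases (h : Partner m n e f) :
    (∃ i k j l, e = ver j l ∧ f = hor i k) ∨ ∃ i k j l, e = hor i k ∧ f = ver j l := by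
  obtain ⟨g, i, k, -, -, h⟩ := h
  grind

theorem Partner.eq_or_eq (he : Partner m n f e) (hg : Partner m n f g) (hne : e ≠ g)
    (hx : Partner m' n' f x) : x = e ∨ x = g := by
  grind [partner_cases, partner_ver_hor, partner_hor_ver]

theorem exists_partner (hm : 0 < m) (hn : 0 < n) (he : e.Valid m n) (hb : e ≠ bot)
    (ht : e ≠ top) : ∃ f, Partner m n e f := by
  cases e with
  | bot => exact absurd rfl hb
  | top => exact absurd rfl ht
  | hor i k =>
    rcases he.2.eq_or_lt with rfl | hk
    · exact ⟨ver (i + 1) (k - 1), partner_hor_ver.2 (by have := he.1; omega)⟩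
    · exact ⟨ver i k, partner_hor_ver.2 (by have := he.1; omega)⟩
  | ver i k =>
    rcases he.1.eq_or_lt with rfl | hi
    · exact ⟨hor (i - 1) (k + 1), partner_ver_hor.2 (by have := he.2; omega)⟩
    · exact ⟨hor i k, partner_ver_hor.2 (by have := he.2; omega)⟩

/-- `{e, f}` is a connected component of the partner relation. -/
def IsolatedPair (m n : ℕ) (e f : GridEdge) : Prop :=
  Partner m n e f ∧ (∀ x, Partner m n e x → x = f) ∧ ∀ x, Partner m n f x → x = e

theorem IsolatedPair.symm (h : IsolatedPair m n e f) : IsolatedPair m n f e :=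
  ⟨partner_comm.1 h.1, h.2.2, h.2.1⟩

theorem isolatedPair_first (hm : 0 < m) (hn : 0 < n) :
    IsolatedPair m n (ver 0 0) (hor 0 0) := by
  refine ⟨partner_ver_hor.2 (by omega), fun x hx => ?_, fun x hx => ?_⟩ <;>
    grind [partner_cases, partner_ver_hor, partner_hor_ver]

theorem IsolatedPair.eq_first_or_last {i k j l : ℕ}
    (h : IsolatedPair m n (ver j l) (hor i k)) :
    (ver j l = ver 0 0 ∧ hor i k = hor 0 0) ∨
      (ver j l = ver m (n - 1) ∧ hor i k = hor (m - 1) n) := by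
  have h1 := partner_ver_hor.1 h.1
  have h2 := fun i' k' h' => h.2.1 (hor i' k') (partner_ver_hor.2 h')
  have h3 := fun j' l' h' => h.2.2 (ver j' l') (partner_hor_ver.2 h')
  simp only [hor.injEq, ver.injEq] at h2 h3 ⊢
  have := h2 j l
  have := h2 (j - 1) (l + 1)
  have := h3 i k
  have := h3 (i + 1) (k - 1)
  omega

end GridEdge

/-- A bijection between the edges of two grids that respects the unit squares, given as a map on
all possible edges. -/
structure IsGridIso (m n m' n' : ℕ) (s : GridEdge → GridEdge) : Prop where
  valid : ∀ {e}, e.Valid m n → (s e).Valid m' n'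
  inj : ∀ {e f}, e.Valid m n → f.Valid m n → s e = s f → e = f
  surj : ∀ {e'}, e'.Valid m' n' → ∃ e, e.Valid m n ∧ s e = e'
  opp : ∀ {e f g}, e.Valid m n → f.Valid m n → g.Valid m n →
    (Opp m' n' (s e) (s f) (s g) ↔ Opp m n e f g)

/-- All edges at distance `d` from the corner `(0, 0)` are fixed. -/
def FixesLevel (m n : ℕ) (s : GridEdge → GridEdge) (d : ℕ) : Prop :=
  ∀ i k, i + k = d → (i < m → k ≤ n → s (hor i k) = hor i k) ∧
    (i ≤ m → k < n → s (ver i k) = ver i k)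

/-- The upper sides, read off from the corner `(0, 0)`, of all unit squares whose nearest vertex is
at distance `d` from this corner are fixed edge by edge. -/
def FixesOut (m n : ℕ) (s : GridEdge → GridEdge) (d : ℕ) : Prop :=
  ∀ i k, i + k = d → i < m → k < n →
    s (ver (i + 1) k) = ver (i + 1) k ∧ s (hor i (k + 1)) = hor i (k + 1)

/-- The four edges of the unit square at the corner `(0, 0)` are fixed. -/
def FixesFirstSquare (s : GridEdge → GridEdge) : Prop :=
  (s (ver 0 0) = ver 0 0 ∧ s (hor 0 0) = hor 0 0) ∧
    s (ver 1 0) = ver 1 0 ∧ s (hor 0 1) = hor 0 1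

section

variable {m n d : ℕ} {s : GridEdge → GridEdge}

theorem FixesLevel.flip (h : FixesLevel m n s d) :
    FixesLevel n m (GridEdge.flip ∘ s ∘ GridEdge.flip) d := fun i k hd =>
  ⟨fun hi hk => congrArg GridEdge.flip ((h k i (by omega)).2 hk hi),
    fun hi hk => congrArg GridEdge.flip ((h k i (by omega)).1 hk hi)⟩

theorem FixesOut.flip (h : FixesOut m n s d) :
    FixesOut n m (GridEdge.flip ∘ s ∘ GridEdge.flip) d := fun i k hd hi hk =>
  ⟨congrArg GridEdge.flip (h k i (by omega) hk hi).2,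
    congrArg GridEdge.flip (h k i (by omega) hk hi).1⟩

end

theorem isGridIso_flip (m n : ℕ) : IsGridIso m n n m GridEdge.flip where
  valid := Valid.flip
  inj {e f} _ _ h := by rw [← GridEdge.flip_flip e, h, GridEdge.flip_flip]
  surj {e} he := ⟨e.flip, he.flip, GridEdge.flip_flip e⟩
  opp {e f g} _ _ _ := ⟨fun h => by simpa only [GridEdge.flip_flip] using h.flip, Opp.flip⟩

namespace IsGridIso

variable {m n m' n' m'' n'' d : ℕ} {s : GridEdge → GridEdge} {e f g : GridEdge}

theorem comp {t : GridEdge → GridEdge} (ht : IsGridIso m' n' m'' n'' t)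
    (hs : IsGridIso m n m' n' s) : IsGridIso m n m'' n'' (t ∘ s) where
  valid he := ht.valid (hs.valid he)
  inj he hf h := hs.inj he hf (ht.inj (hs.valid he) (hs.valid hf) h)
  surj he'' := by
    obtain ⟨e', he', rfl⟩ := ht.surj he''
    obtain ⟨e, he, rfl⟩ := hs.surj he'
    exact ⟨e, he, rfl⟩
  opp he hf hg := (ht.opp (hs.valid he) (hs.valid hf) (hs.valid hg)).trans (hs.opp he hf hg)

theorem flip (h : IsGridIso m n m' n' s) :
    IsGridIso n m n' m' (GridEdge.flip ∘ s ∘ GridEdge.flip) :=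
  (isGridIso_flip m' n').comp (h.comp (isGridIso_flip n m))

theorem partner (h : IsGridIso m n m' n' s) (hp : Partner m n e f) :
    Partner m' n' (s e) (s f) :=
  hp.elim fun g hg => ⟨s g, (h.opp hg.valid.1 hg.valid.2.1 hg.valid.2.2).2 hg⟩

theorem exists_partner_of_partner (h : IsGridIso m n m' n' s) (he : e.Valid m n)
    (hp : Partner m' n' (s e) f) : ∃ x, Partner m n e x ∧ s x = f := by
  obtain ⟨g, hg⟩ := hp
  obtain ⟨x, hx, rfl⟩ := h.surj hg.valid.2.1
  obtain ⟨y, hy, rfl⟩ := h.surj hg.valid.2.2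
  exact ⟨x, ⟨y, (h.opp he hx hy).1 hg⟩, rfl⟩

theorem isolatedPair (h : IsGridIso m n m' n' s) (hp : IsolatedPair m n e f) :
    IsolatedPair m' n' (s e) (s f) := by
  refine ⟨h.partner hp.1, fun x hx => ?_, fun x hx => ?_⟩
  · obtain ⟨y, hy, rfl⟩ := h.exists_partner_of_partner hp.1.valid.1 hx
    rw [hp.2.1 y hy]
  · obtain ⟨y, hy, rfl⟩ := h.exists_partner_of_partner hp.1.valid.2 hx
    rw [hp.2.2 y hy]

theorem eq_of_fixed_partner (h : IsGridIso m n m' n' s) (he : Partner m n f e)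
    (hg : Partner m n f g) (hne : e ≠ g) (hf : s f = f) (hse : s e = e) : s g = g := by
  refine (he.eq_or_eq hg hne (hf ▸ h.partner hg)).resolve_left fun hs => hne ?_
  exact h.inj he.valid.2 hg.valid.2 (hse.trans hs.symm)

theorem out_of_in (h : IsGridIso m n m' n' s) {i k : ℕ} (hi : i < m) (hk : k < n)
    (hv : s (ver i k) = ver i k) (hh : s (hor i k) = hor i k) :
    i < m' ∧ k < n' ∧
      ((s (ver (i + 1) k) = ver (i + 1) k ∧ s (hor i (k + 1)) = hor i (k + 1)) ∨
        (s (ver (i + 1) k) = hor i (k + 1) ∧ s (hor i (k + 1)) = ver (i + 1) k)) := by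
  have image {g : GridEdge} (hg : Opp m n (ver i k) (hor i k) g) :
      i < m' ∧ k < n' ∧ (s g = ver (i + 1) k ∨ s g = hor i (k + 1)) := by
    have := (h.opp hg.valid.1 hg.valid.2.1 hg.valid.2.2).2 hg
    rw [hv, hh, opp_ver_hor] at this
    grind
  have h1 : Opp m n (ver i k) (hor i k) (ver (i + 1) k) := opp_ver_hor.2 (by simp [hi, hk])
  have h2 : Opp m n (ver i k) (hor i k) (hor i (k + 1)) := opp_ver_hor.2 (by simp [hi, hk])
  have hne : s (ver (i + 1) k) ≠ s (hor i (k + 1)) := fun he => by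
    simpa using h.inj h1.valid.2.2 h2.valid.2.2 he
  obtain ⟨hi', hk', h1⟩ := image h1
  obtain ⟨-, -, h2⟩ := image h2
  refine ⟨hi', hk', ?_⟩
  grind

theorem hor_eq_of_fixesOut (h : IsGridIso m n m' n' s) (hn : 0 < n) (hout : FixesOut m n s d)
    {i k : ℕ} (hd : i + k = d + 1) (hi : i < m) (hk : k ≤ n) : s (hor i k) = hor i k := by
  obtain _ | k := k
  · obtain rfl : i = d + 1 := by omega
    obtain ⟨h1, h2⟩ := hout d 0 rfl (by omega) hn
    exact h.eq_of_fixed_partner (partner_ver_hor.2 (by omega)) (partner_ver_hor.2 (by omega))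
      (by simp) h1 h2
  · exact (hout i k (by omega) hi hk).2

theorem fixesLevel_succ (h : IsGridIso m n m' n' s) (hm : 0 < m) (hn : 0 < n)
    (hout : FixesOut m n s d) : FixesLevel m n s (d + 1) := fun i k hd => by
  refine ⟨h.hor_eq_of_fixesOut hn hout hd, fun hi hk => ?_⟩
  have := h.flip.hor_eq_of_fixesOut hm hout.flip (i := k) (k := i) (by omega) hk hi
  rw [← GridEdge.flip_flip (s (ver i k))]
  exact congrArg GridEdge.flip this

theorem ver_ne_of_next_square (h : IsGridIso m n m' n' s) (hl : FixesLevel m n s d) {i l : ℕ}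
    (hd : i + (l + 1) = d) (hi : i + 1 < m) (hk : l + 1 < n) :
    s (ver (i + 1) (l + 1)) ≠ hor i (l + 2) := by
  intro h1
  have hp := h.partner (partner_ver_hor.2 (by omega) :
    Partner m n (ver (i + 1) (l + 1)) (hor (i + 1) (l + 1)))
  obtain ⟨-, -, ⟨-, h2⟩ | ⟨-, h2⟩⟩ := h.out_of_in (i := i + 1) (k := l) hi (by omega)
    ((hl (i + 1) l (by omega)).2 hi.le (by omega)) ((hl (i + 1) l (by omega)).1 hi (by omega))
  all_goals
    rw [h1, h2] at hp
    grind [partner_cases, partner_hor_ver]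

/-- In a grid of width one, an exchange of the outgoing edges forces the target grid to be wider,
but there the edge `ver 1 l` has two partners. -/
theorem not_out_swapped_of_width_one (h : IsGridIso 1 n m' n' s) {l : ℕ}
    (hl : FixesLevel 1 n s (l + 1)) (hk : l + 2 < n) :
    ¬ (s (ver 1 (l + 1)) = hor 0 (l + 2) ∧ s (hor 0 (l + 2)) = ver 1 (l + 1)) := by
  rintro ⟨h1, h2⟩
  have hm' : 1 < m' := by
    have hv : Partner 1 n (hor 0 (l + 2)) (ver 0 (l + 2)) := partner_hor_ver.2 (by omega)
    have hp := h.partner hv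
    have hne : s (ver 0 (l + 2)) ≠ hor 0 (l + 2) := fun he => by
      simpa using h.inj hv.valid.2 (f := ver 1 (l + 1)) ⟨le_rfl, by omega⟩ (he.trans h1.symm)
    rw [h2] at hp
    grind [partner_cases, partner_ver_hor]
  have hver : s (ver 1 l) = ver 1 l := (hl 1 l (by omega)).2 le_rfl (by omega)
  have hhor : s (hor 0 (l + 1)) = hor 0 (l + 1) := (hl 0 (l + 1) (by omega)).1 one_pos (by omega)
  have hv : (ver 1 l).Valid 1 n := ⟨le_rfl, by omega⟩
  have hn' : l < n' := (hver ▸ h.valid hv : (ver 1 l).Valid m' n').2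
  obtain ⟨x, hx, hsx⟩ := h.exists_partner_of_partner hv (f := hor 1 l) (by
    rw [hver, partner_ver_hor]
    omega)
  grind [partner_cases, partner_ver_hor]

theorem not_out_swapped (h : IsGridIso m n m' n' s) (hl : FixesLevel m n s d) {i l : ℕ}
    (hd : i + (l + 1) = d) (hk : l + 1 < n) (hi : i + 1 < m ∨ m = 1 ∧ i = 0 ∧ l + 2 < n) :
    ¬ (s (ver (i + 1) (l + 1)) = hor i (l + 2) ∧ s (hor i (l + 2)) = ver (i + 1) (l + 1)) := by
  rcases hi with hi | ⟨rfl, rfl, hn⟩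
  · exact fun h' => h.ver_ne_of_next_square hl hd hi hk h'.1
  · obtain rfl : l + 1 = d := by omega
    exact h.not_out_swapped_of_width_one hl hn

theorem fixesOut (h : IsGridIso m n m' n' s) (hd : 0 < d) (hdm : d + 2 < m + n)
    (hl : FixesLevel m n s d) : FixesOut m n s d := by
  intro i k hik hi hk
  obtain ⟨-, -, hfix | ⟨h1, h2⟩⟩ :=
    h.out_of_in hi hk ((hl i k hik).2 hi.le hk) ((hl i k hik).1 hi hk.le)
  · exact hfix
  obtain ⟨hk0, hc⟩ | ⟨hi0, hc⟩ :
      (0 < k ∧ (i + 1 < m ∨ m = 1 ∧ i = 0 ∧ k + 1 < n)) ∨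
        (0 < i ∧ (k + 1 < n ∨ n = 1 ∧ k = 0 ∧ i + 1 < m)) := by omega
  · obtain ⟨l, rfl⟩ := Nat.exists_eq_add_one.2 hk0
    exact absurd ⟨h1, h2⟩ (h.not_out_swapped hl hik hk hc)
  · obtain ⟨j, rfl⟩ := Nat.exists_eq_add_one.2 hi0
    exact absurd ⟨congrArg GridEdge.flip h2, congrArg GridEdge.flip h1⟩
      (h.flip.not_out_swapped hl.flip (by omega) hi hc)

theorem fixesLevel (h : IsGridIso m n m' n' s) (hm : 0 < m) (hn : 0 < n)
    (hs : FixesFirstSquare s) (hd : d + 2 ≤ m + n) : FixesLevel m n s d := by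
  induction d with
  | zero =>
    intro i k hik
    obtain ⟨rfl, rfl⟩ : i = 0 ∧ k = 0 := by omega
    exact ⟨fun _ _ => hs.1.2, fun _ _ => hs.1.1⟩
  | succ d ih =>
    refine h.fixesLevel_succ hm hn ?_
    obtain rfl | hd0 := Nat.eq_zero_or_pos d
    · intro i k hik _ _
      obtain ⟨rfl, rfl⟩ : i = 0 ∧ k = 0 := by omega
      exact hs.2
    · exact h.fixesOut hd0 (by omega) (ih (by omega))

theorem size_le_and_last_pair (h : IsGridIso m n m' n' s) (hm : 0 < m) (hn : 0 < n)
    (hs : FixesFirstSquare s) : (m ≤ m' ∧ n ≤ n') ∧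
    ((s (ver m (n - 1)) = ver m (n - 1) ∧ s (hor (m - 1) n) = hor (m - 1) n) ∨
      (s (ver m (n - 1)) = hor (m - 1) n ∧ s (hor (m - 1) n) = ver m (n - 1))) := by
  obtain ⟨m, rfl⟩ := Nat.exists_eq_add_one.2 hm
  obtain ⟨n, rfl⟩ := Nat.exists_eq_add_one.2 hn
  have hl := h.fixesLevel hm hn hs (d := m + n) (by omega) m n rfl
  obtain ⟨hm', hn', hlast⟩ := h.out_of_in (by omega) (by omega)
    (hl.2 (by omega) (by omega)) (hl.1 (by omega) (by omega))
  exact ⟨⟨hm', hn'⟩, hlast⟩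

theorem first_pair (h : IsGridIso m n m' n' s) (hm : 0 < m) (hn : 0 < n) :
    (s (ver 0 0) = ver 0 0 ∧ s (hor 0 0) = hor 0 0) ∨
      (s (ver 0 0) = hor 0 0 ∧ s (hor 0 0) = ver 0 0) ∨
      (s (ver 0 0) = ver m' (n' - 1) ∧ s (hor 0 0) = hor (m' - 1) n') ∨
      (s (ver 0 0) = hor (m' - 1) n' ∧ s (hor 0 0) = ver m' (n' - 1)) := by
  have hp := h.isolatedPair (isolatedPair_first hm hn)
  obtain ⟨i, k, j, l, h1, h2⟩ | ⟨i, k, j, l, h1, h2⟩ := partner_cases hp.1 <;> rw [h1, h2] at hp ⊢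
  · exact hp.eq_first_or_last.imp_right fun h => .inr (.inl h)
  · exact .inr (hp.symm.eq_first_or_last.imp And.symm fun h => .inr h.symm)

theorem eq_bot_or_top (h : IsGridIso m n m' n' s) (hm' : 0 < m') (hn' : 0 < n')
    (hv : e.Valid m n) (he : ∀ f, ¬ Partner m n e f) : s e = bot ∨ s e = top := by
  by_contra! hne
  obtain ⟨f, hf⟩ := exists_partner hm' hn' (h.valid hv) hne.1 hne.2
  obtain ⟨x, hx, -⟩ := h.exists_partner_of_partner hv hf
  exact he x hx

end IsGridIso

/-! ### Generators of the automorphism group -/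

instance (m n : ℕ) : DecidablePred (Valid m n) := fun e => by
  cases e <;> unfold Valid <;> infer_instance

section Generators

open Equiv.Perm (ofSubtype)

variable {m n : ℕ} {σ : Equiv.Perm (Edges m n)} {H : Subgroup (Equiv.Perm (Edges m n))}

theorem isGridIso_of_mem (hσ : σ ∈ gridAut m n) : IsGridIso m n m n (ofSubtype σ) where
  valid he := by
    rw [Equiv.Perm.ofSubtype_apply_of_mem σ he]
    exact (σ _).2
  inj _ _ h := (ofSubtype σ).injective h
  surj {e'} he' := by
    refine ⟨(σ.symm ⟨e', he'⟩).1, (σ.symm ⟨e', he'⟩).2, ?_⟩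
    rw [Equiv.Perm.ofSubtype_apply_coe, Equiv.apply_symm_apply]
  opp {e f g} he hf hg := by
    obtain ⟨φ, rfl⟩ := hσ
    have key := isHasseDiagram_grid.isIrredundant.tightImp_facetHom φ ⟨e, he⟩ ⟨f, hf⟩ ⟨g, hg⟩
    rw [tightImp_grid_iff, tightImp_grid_iff, EmbeddingLike.apply_eq_iff_eq,
      EmbeddingLike.apply_eq_iff_eq] at key
    rw [Equiv.Perm.ofSubtype_apply_of_mem _ he, Equiv.Perm.ofSubtype_apply_of_mem _ hf,
      Equiv.Perm.ofSubtype_apply_of_mem _ hg]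
    constructor <;> intro h
    · exact ((key.1 (.inr (.inr h))).resolve_left fun h' => h.ne.1 (by simp [h'])).resolve_left
        fun h' => h.ne.2 (by simp [h'])
    · exact ((key.2 (.inr (.inr h))).resolve_left fun h' => h.ne.1 (by simpa using h')).resolve_left
        fun h' => h.ne.2 (by simpa using h')

/-- Exchange of the two edges at the corner `(m, n)`. -/
def lastSwap (hm : 0 < m) (hn : 0 < n) : Equiv.Perm (Edges m n) :=
  Equiv.swap ⟨hor (m - 1) n, Nat.sub_lt hm one_pos, le_rfl⟩
    ⟨ver m (n - 1), le_rfl, Nat.sub_lt hn one_pos⟩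

theorem rotPerm_mul_self : rotPerm m n * rotPerm m n = 1 :=
  Equiv.ext fun e => Subtype.ext e.2.rot_rot

theorem rotPerm_conj_cornerSwap (hm : 0 < m) (hn : 0 < n) :
    rotPerm m n * cornerSwap hm hn * rotPerm m n = lastSwap hm hn := by
  rw [cornerSwap, Equiv.mul_swap_eq_swap_mul, mul_assoc, rotPerm_mul_self, mul_one]
  rfl

theorem IsGridIso.apply_eq_self {s : GridEdge → GridEdge} (h : IsGridIso m n m n s) (hm : 0 < m)
    (hn : 0 < n) (hs : FixesFirstSquare s)
    (hl : s (ver m (n - 1)) = ver m (n - 1) ∧ s (hor (m - 1) n) = hor (m - 1) n) {e : GridEdge}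
    (he : e.Valid m n) (hb : e ≠ bot) (ht : e ≠ top) : s e = e := by
  cases e with
  | bot => exact absurd rfl hb
  | top => exact absurd rfl ht
  | hor i k =>
    obtain ⟨hi, hk⟩ := he
    by_cases hd : i + k + 2 ≤ m + n
    · exact (h.fixesLevel hm hn hs hd i k rfl).1 hi hk
    · obtain ⟨rfl, rfl⟩ : i = m - 1 ∧ k = n := by omega
      exact hl.2
  | ver i k =>
    obtain ⟨hi, hk⟩ := he
    by_cases hd : i + k + 2 ≤ m + n
    · exact (h.fixesLevel hm hn hs hd i k rfl).2 hi hk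
    · obtain ⟨rfl, rfl⟩ : i = m ∧ k = n - 1 := by omega
      exact hl.1

theorem eq_one_or_eq_apexSwap (hσ : σ ∈ gridAut m n) (hm : 0 < m) (hn : 0 < n)
    (hs : FixesFirstSquare (ofSubtype σ)) (hl : ofSubtype σ (ver m (n - 1)) = ver m (n - 1) ∧
      ofSubtype σ (hor (m - 1) n) = hor (m - 1) n) : σ = 1 ∨ σ = apexSwap m n := by
  have h := isGridIso_of_mem hσ
  have hfix {e : GridEdge} := h.apply_eq_self (e := e) hm hn hs hl
  have hb := h.eq_bot_or_top (e := bot) hm hn trivial fun f hf => by grind [partner_cases]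
  have ht := h.eq_bot_or_top (e := top) hm hn trivial fun f hf => by grind [partner_cases]
  have hne : ofSubtype σ bot ≠ ofSubtype σ top := (ofSubtype σ).injective.ne (by simp)
  have ext (τ : Equiv.Perm (Edges m n))
      (h : ∀ e : GridEdge, e.Valid m n → ofSubtype σ e = ofSubtype τ e) : σ = τ :=
    Equiv.ext fun e => Subtype.ext (by simpa using h e.1 e.2)
  rcases hb with hb | hb
  · refine .inl (ext 1 fun e he => ?_)
    rw [map_one, Equiv.Perm.one_apply]
    by_cases e = bot <;> by_cases e = top <;> grind
  · refine .inr (ext _ fun e he => ?_)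
    rw [apexSwap, Equiv.Perm.ofSubtype_swap_eq, Equiv.swap_apply_def]
    grind

theorem lastSwap_mem_gridAut (hm : 0 < m) (hn : 0 < n) : lastSwap hm hn ∈ gridAut m n := by
  rw [← rotPerm_conj_cornerSwap]
  exact mul_mem (mul_mem rotPerm_mem (cornerSwap_mem hm hn)) rotPerm_mem

theorem mem_of_fixesFirstSquare (hm : 0 < m) (hn : 0 < n) (ht : apexSwap m n ∈ H)
    (hl : lastSwap hm hn ∈ H) (hσ : σ ∈ gridAut m n) (hs : FixesFirstSquare (ofSubtype σ)) :
    σ ∈ H := by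
  have mem {τ : Equiv.Perm (Edges m n)} (h : τ = 1 ∨ τ = apexSwap m n) : τ ∈ H := by
    rcases h with rfl | rfl
    exacts [one_mem H, ht]
  obtain ⟨-, hlast | ⟨hver, hhor⟩⟩ := (isGridIso_of_mem hσ).size_le_and_last_pair hm hn hs
  · exact mem (eq_one_or_eq_apexSwap hσ hm hn hs hlast)
  · refine (H.mul_mem_cancel_left hl).1 (mem (eq_one_or_eq_apexSwap
      (mul_mem (lastSwap_mem_gridAut hm hn) hσ) hm hn ?_ ?_)) <;>
    simp only [FixesFirstSquare, map_mul, Equiv.Perm.mul_apply, lastSwap,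
      Equiv.Perm.ofSubtype_swap_eq, Equiv.swap_apply_def] at hs ⊢ <;>
    grind

theorem eq_of_out_swapped (hm : 0 < m) (hn : 0 < n) (hσ : σ ∈ gridAut m n)
    (hin : ofSubtype σ (ver 0 0) = ver 0 0 ∧ ofSubtype σ (hor 0 0) = hor 0 0)
    (hout : ofSubtype σ (ver 1 0) = hor 0 1 ∧ ofSubtype σ (hor 0 1) = ver 1 0) : m = n := by
  have h := (isGridIso_of_mem (mul_mem (cornerSwap_mem hm hn) hσ)).comp (isGridIso_flip n m)
  have := (h.size_le_and_last_pair hn hm (by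
    simp [FixesFirstSquare, GridEdge.flip, cornerSwap, Equiv.Perm.ofSubtype_swap_eq, hin, hout,
      Equiv.swap_apply_of_ne_of_ne])).1
  omega

/-- A permutation `τ` as in `hf` exists only for `m = n`, where it is the exchange of the
coordinates; this form avoids a case distinction on `m = n`. -/
theorem mem_of_fixes_in (hm : 0 < m) (hn : 0 < n) (ht : apexSwap m n ∈ H)
    (hl : lastSwap hm hn ∈ H) (hc : cornerSwap hm hn ∈ H)
    (hf : ∀ τ : Equiv.Perm (Edges m n), (∀ e, (τ e).1 = e.1.flip) → τ ∈ H) (hσ : σ ∈ gridAut m n)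
    (hin : ofSubtype σ (ver 0 0) = ver 0 0 ∧ ofSubtype σ (hor 0 0) = hor 0 0) : σ ∈ H := by
  obtain ⟨-, -, hout | hout⟩ := (isGridIso_of_mem hσ).out_of_in hm hn hin.1 hin.2
  · exact mem_of_fixesFirstSquare hm hn ht hl hσ ⟨hin, hout⟩
  · obtain rfl := eq_of_out_swapped hm hn hσ hin hout
    have hflip {e : GridEdge} (he : e.Valid m m) : ofSubtype (flipEquiv m m) e = e.flip :=
      Equiv.Perm.ofSubtype_apply_of_mem _ he
    have hs : FixesFirstSquare
        (ofSubtype (cornerSwap hm hn * ((flipEquiv m m : Equiv.Perm (Edges m m)) * σ))) := by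
      have valid : Valid m m (ver 0 0) ∧ Valid m m (hor 0 0) ∧ Valid m m (ver 1 0) ∧
          Valid m m (hor 0 1) := by
        simp only [Valid]
        omega
      simp [FixesFirstSquare, hin, hout, hflip, valid, GridEdge.flip, cornerSwap,
        Equiv.Perm.ofSubtype_swap_eq, Equiv.swap_apply_of_ne_of_ne]
    exact (H.mul_mem_cancel_left (hf (flipEquiv m m) fun _ => rfl)).1
      ((H.mul_mem_cancel_left hc).1 (mem_of_fixesFirstSquare hm hn ht hl
        (mul_mem (cornerSwap_mem hm hn) (mul_mem flipEquiv_mem hσ)) hs))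

theorem mem_of_preserves_in (hm : 0 < m) (hn : 0 < n) (ht : apexSwap m n ∈ H)
    (hl : lastSwap hm hn ∈ H) (hc : cornerSwap hm hn ∈ H)
    (hf : ∀ τ : Equiv.Perm (Edges m n), (∀ e, (τ e).1 = e.1.flip) → τ ∈ H) (hσ : σ ∈ gridAut m n)
    (hin : (ofSubtype σ (ver 0 0) = ver 0 0 ∧ ofSubtype σ (hor 0 0) = hor 0 0) ∨
      (ofSubtype σ (ver 0 0) = hor 0 0 ∧ ofSubtype σ (hor 0 0) = ver 0 0)) : σ ∈ H := by
  rcases hin with hin | hin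
  · exact mem_of_fixes_in hm hn ht hl hc hf hσ hin
  · refine (H.mul_mem_cancel_left hc).1 (mem_of_fixes_in hm hn ht hl hc hf
      (mul_mem (cornerSwap_mem hm hn) hσ) ?_)
    simp [cornerSwap, Equiv.Perm.ofSubtype_swap_eq, hin]

theorem gridAut_le (hm : 0 < m) (hn : 0 < n) (ht : apexSwap m n ∈ H) (hr : rotPerm m n ∈ H)
    (hc : cornerSwap hm hn ∈ H)
    (hf : ∀ τ : Equiv.Perm (Edges m n), (∀ e, (τ e).1 = e.1.flip) → τ ∈ H) : gridAut m n ≤ H := by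
  intro σ hσ
  have hl : lastSwap hm hn ∈ H := by
    rw [← rotPerm_conj_cornerSwap]
    exact mul_mem (mul_mem hr hc) hr
  have rv : ofSubtype (rotPerm m n) (ver m (n - 1)) = ver 0 0 := by
    rw [Equiv.Perm.ofSubtype_apply_of_mem _ (by simp only [Valid]; omega)]
    simp [rotPerm, GridEdge.rot]
  have rh : ofSubtype (rotPerm m n) (hor (m - 1) n) = hor 0 0 := by
    rw [Equiv.Perm.ofSubtype_apply_of_mem _ (by simp only [Valid]; omega)]
    simp [rotPerm, GridEdge.rot]
  obtain hin | hin | hin | hin := (isGridIso_of_mem hσ).first_pair hm hn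
  · exact mem_of_preserves_in hm hn ht hl hc hf hσ (.inl hin)
  · exact mem_of_preserves_in hm hn ht hl hc hf hσ (.inr hin)
  all_goals
    refine (H.mul_mem_cancel_left hr).1 (mem_of_preserves_in hm hn ht hl hc hf
      (mul_mem rotPerm_mem hσ) ?_)
    simp [hin, rv, rh]

end Generators

/-! ### The automorphism group of the grid -/

section Homs

variable {G K : Type*} [Group G] [Group K] {N : ℕ} [NeZero N]

/-- The homomorphism from a cyclic group of order `N` given by an element `a` with `a ^ N = 1`. -/
def zmodPowHom (a : G) (ha : a ^ N = 1) : Multiplicative (ZMod N) →* G where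
  toFun z := a ^ z.toAdd.val
  map_one' := by simp
  map_mul' x y := by rw [toAdd_mul, ZMod.val_add, ← pow_add, ← pow_eq_pow_mod _ ha]

theorem zmodPowHom_apply (a : G) (ha : a ^ N = 1) (z : Multiplicative (ZMod N)) :
    zmodPowHom a ha z = a ^ z.toAdd.val := rfl

theorem zmodPowHom_ofAdd_one (a : G) (ha : a ^ N = 1) : zmodPowHom a ha (.ofAdd 1) = a := by
  rw [zmodPowHom_apply, toAdd_ofAdd, ZMod.val_one_eq_one_mod, ← pow_eq_pow_mod _ ha, pow_one]

theorem zmodPowHom_range (a : G) (ha : a ^ N = 1) :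
    (zmodPowHom a ha).range = Subgroup.zpowers a := by
  refine le_antisymm ?_ (Subgroup.zpowers_le.2 ⟨.ofAdd 1, zmodPowHom_ofAdd_one a ha⟩)
  rintro _ ⟨z, rfl⟩
  exact Subgroup.npow_mem_zpowers a _

/-- The homomorphism from a dihedral group given by elements satisfying its relations. -/
def dihedralHom (a b : G) (ha : a ^ N = 1) (hb : b * b = 1) (hab : b * a * b = a⁻¹) :
    DihedralGroup N →* G where
  toFun
    | .r i => zmodPowHom a ha (.ofAdd i)
    | .sr i => b * zmodPowHom a ha (.ofAdd i)
  map_one' := map_one (zmodPowHom a ha)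
  map_mul' x y := by
    have hb' : b⁻¹ = b := inv_eq_of_mul_eq_one_left hb
    have hconj : ∀ i, zmodPowHom a ha i * b = b * (zmodPowHom a ha i)⁻¹ := fun i => by
      have hab' : b * a * b⁻¹ = a⁻¹ := by rw [hb', hab]
      rw [zmodPowHom_apply, ← inv_pow, ← hab', conj_pow, hb', ← mul_assoc, ← mul_assoc, hb, one_mul]
    rcases x with i | i <;> rcases y with j | j
    · exact map_mul (zmodPowHom a ha) (.ofAdd i) (.ofAdd j)
    · change b * zmodPowHom a ha (.ofAdd j / .ofAdd i) = _
      rw [div_eq_inv_mul, map_mul, map_inv, ← mul_assoc, ← mul_assoc, hconj]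
    · change b * zmodPowHom a ha (.ofAdd i * .ofAdd j) = _
      rw [map_mul, mul_assoc]
    · change zmodPowHom a ha (.ofAdd j / .ofAdd i) =
        b * zmodPowHom a ha (.ofAdd i) * (b * zmodPowHom a ha (.ofAdd j))
      rw [div_eq_inv_mul, map_mul, map_inv, mul_assoc, ← mul_assoc _ b, hconj, ← mul_assoc,
        ← mul_assoc, hb, one_mul]

theorem dihedralHom_range {a b : G} (ha : a ^ N = 1) (hb : b * b = 1) (hab : b * a * b = a⁻¹) :
    (dihedralHom a b ha hb hab).range = Subgroup.closure {a, b} := by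
  have mem_a : a ∈ Subgroup.closure {a, b} := Subgroup.subset_closure (by simp)
  have mem_b : b ∈ Subgroup.closure {a, b} := Subgroup.subset_closure (by simp)
  refine le_antisymm ?_ ((Subgroup.closure_le _).2 ?_)
  · rintro _ ⟨i | i, rfl⟩
    exacts [pow_mem mem_a _, mul_mem mem_b (pow_mem mem_a _)]
  · rintro _ (rfl | rfl)
    · exact ⟨.r 1, zmodPowHom_ofAdd_one _ ha⟩
    · exact ⟨.sr 0, (congrArg _ (map_one (zmodPowHom a ha))).trans (mul_one _)⟩

/-- The extension of a homomorphism by a commuting element `c` with `c ^ 2 = 1`. -/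
def adjoinInvolution (f : K →* G) (c : G) (hc : c ^ 2 = 1) (comm : ∀ x, Commute (f x) c) :
    K × Multiplicative (ZMod 2) →* G :=
  f.noncommCoprod (zmodPowHom c hc) fun x z => by
    rw [zmodPowHom_apply]
    exact (comm x).pow_right _

theorem adjoinInvolution_range (f : K →* G) (c : G) (hc : c ^ 2 = 1)
    (comm : ∀ x, Commute (f x) c) :
    (adjoinInvolution f c hc comm).range = f.range ⊔ Subgroup.zpowers c := by
  rw [adjoinInvolution, MonoidHom.noncommCoprod_range, zmodPowHom_range]

theorem adjoinInvolution_injective {f : K →* G} {c : G} (hc : c ^ 2 = 1)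
    (comm : ∀ x, Commute (f x) c) (hf : Function.Injective f) (hcf : c ∉ f.range) :
    Function.Injective (adjoinInvolution f c hc comm) := by
  have cases_two : ∀ z : Multiplicative (ZMod 2), z = 1 ∨ z = .ofAdd 1 := by decide
  rw [adjoinInvolution, MonoidHom.noncommCoprod_injective]
  refine ⟨hf, (injective_iff_map_eq_one _).2 fun z hz => ?_, Subgroup.disjoint_def.2 ?_⟩
  · obtain rfl | rfl := cases_two z
    · rfl
    · rw [zmodPowHom_ofAdd_one] at hz
      exact absurd (hz ▸ one_mem _) hcf
  · rintro _ hx ⟨z, rfl⟩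
    obtain rfl | rfl := cases_two z
    · exact map_one _
    · exact absurd (zmodPowHom_ofAdd_one c hc ▸ hx) hcf

end Homs

theorem commute_swap_of_apply {X : Type*} [DecidableEq X] {σ : Equiv.Perm X} {x y : X}
    (h : (σ x = x ∧ σ y = y) ∨ (σ x = y ∧ σ y = x)) : Commute σ (Equiv.swap x y) := by
  rw [Commute, SemiconjBy, Equiv.mul_swap_eq_swap_mul]
  rcases h with ⟨h1, h2⟩ | ⟨h1, h2⟩
  · rw [h1, h2]
  · rw [h1, h2, Equiv.swap_comm]

section Structure

variable {m n : ℕ} (hm : 0 < m) (hn : 0 < n)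

theorem apexSwap_sq : apexSwap m n ^ 2 = 1 := by
  rw [sq]
  exact Equiv.swap_mul_self _ _

theorem apexSwap_apply {e : Edges m n} (hb : e.1 ≠ bot) (ht : e.1 ≠ top) : apexSwap m n e = e :=
  Equiv.swap_apply_of_ne_of_ne (fun h => hb (congrArg Subtype.val h))
    fun h => ht (congrArg Subtype.val h)

theorem cornerSwap_apply {e : Edges m n} (hh : e.1 ≠ hor 0 0) (hv : e.1 ≠ ver 0 0) :
    cornerSwap hm hn e = e :=
  Equiv.swap_apply_of_ne_of_ne (fun h => hh (congrArg Subtype.val h))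
    fun h => hv (congrArg Subtype.val h)

theorem cornerSwap_commute_apexSwap : Commute (cornerSwap hm hn) (apexSwap m n) :=
  commute_swap_of_apply (.inl ⟨cornerSwap_apply hm hn (by simp) (by simp),
    cornerSwap_apply hm hn (by simp) (by simp)⟩)

theorem rotPerm_commute_apexSwap : Commute (rotPerm m n) (apexSwap m n) :=
  commute_swap_of_apply (.inr ⟨rfl, rfl⟩)

theorem cornerSwap_commute_lastSwap : Commute (cornerSwap hm hn) (lastSwap hm hn) :=
  commute_swap_of_apply (.inl ⟨cornerSwap_apply hm hn (by simp; omega) (by simp),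
    cornerSwap_apply hm hn (by simp) (by simp; omega)⟩)

/-- The composition of the half turn and the corner exchange, a symmetry of order four. -/
def quarter : Equiv.Perm (Edges m n) := cornerSwap hm hn * rotPerm m n

theorem quarter_pow_four : quarter hm hn ^ 4 = 1 := by
  have sq_eq : quarter hm hn ^ 2 = cornerSwap hm hn * lastSwap hm hn := by
    rw [← rotPerm_conj_cornerSwap, quarter, sq]
    simp only [mul_assoc]
  rw [show 4 = 2 * 2 from rfl, pow_mul, sq_eq, (cornerSwap_commute_lastSwap hm hn).mul_pow, sq,
    sq, cornerSwap, lastSwap, Equiv.swap_mul_self, Equiv.swap_mul_self, one_mul]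

theorem rotPerm_conj_quarter :
    rotPerm m n * quarter hm hn * rotPerm m n = (quarter hm hn)⁻¹ := by
  rw [quarter, mul_inv_rev, inv_eq_of_mul_eq_one_left rotPerm_mul_self, cornerSwap,
    Equiv.swap_inv, mul_assoc, mul_assoc, rotPerm_mul_self, mul_one]

/-- The action of the dihedral group on the edges. -/
def dihedralAction : DihedralGroup 4 →* Equiv.Perm (Edges m n) :=
  dihedralHom (quarter hm hn) (rotPerm m n) (quarter_pow_four hm hn) rotPerm_mul_self
    (rotPerm_conj_quarter hm hn)

theorem dihedralAction_commute {c : Equiv.Perm (Edges m n)} (hr : Commute (rotPerm m n) c)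
    (hc : Commute (cornerSwap hm hn) c) (d : DihedralGroup 4) :
    Commute (dihedralAction hm hn d) c := by
  have hq : Commute (quarter hm hn) c := hc.mul_left hr
  rcases d with i | i
  exacts [hq.pow_left _, hr.mul_left (hq.pow_left _)]

theorem dihedralAction_range_le {H : Subgroup (Equiv.Perm (Edges m n))} :
    (dihedralAction hm hn).range ≤ H ↔ rotPerm m n ∈ H ∧ cornerSwap hm hn ∈ H := by
  rw [dihedralAction, dihedralHom_range, Subgroup.closure_le, Set.pair_subset_iff,
    SetLike.mem_coe, SetLike.mem_coe, and_comm]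
  exact and_congr_right fun hr => H.mul_mem_cancel_right hr

/-- The four edges at the corners `(0, 0)` and `(m, n)`, in the order in which `quarter` permutes
them. -/
def cornerEdge : ZMod 4 → Edges m n :=
  ![⟨hor 0 0, hm, Nat.zero_le _⟩, ⟨hor (m - 1) n, Nat.sub_lt hm one_pos, le_rfl⟩,
    ⟨ver 0 0, Nat.zero_le _, hn⟩, ⟨ver m (n - 1), le_rfl, Nat.sub_lt hn one_pos⟩]

theorem cornerEdge_injective : Function.Injective (cornerEdge hm hn) := by
  intro i j h
  have hval := congrArg Subtype.val h
  fin_cases i <;> fin_cases j <;> first | rfl | (simp [cornerEdge] at hval <;> omega)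

theorem rotPerm_cornerEdge (j : ZMod 4) :
    rotPerm m n (cornerEdge hm hn j) = cornerEdge hm hn (1 - j) := by
  fin_cases j
  · rfl
  · exact Subtype.ext (congrArg₂ hor (Nat.sub_self _) (Nat.sub_self _))
  · rfl
  · exact Subtype.ext (congrArg₂ ver (Nat.sub_self _) (Nat.sub_self _))

theorem quarter_cornerEdge (j : ZMod 4) :
    quarter hm hn (cornerEdge hm hn j) = cornerEdge hm hn (j + 1) := by
  rw [quarter, Equiv.Perm.mul_apply, rotPerm_cornerEdge]
  fin_cases j
  · exact cornerSwap_apply (e := ⟨hor (m - 1) n, _⟩) hm hn (by simp; omega) (by simp)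
  · exact Equiv.swap_apply_left _ _
  · exact cornerSwap_apply (e := ⟨ver m (n - 1), _⟩) hm hn (by simp) (by simp; omega)
  · exact Equiv.swap_apply_right _ _

theorem quarter_pow_cornerEdge (k : ℕ) (j : ZMod 4) :
    (quarter hm hn ^ k) (cornerEdge hm hn j) = cornerEdge hm hn (j + k) := by
  induction k with
  | zero => simp
  | succ k ih =>
    rw [pow_succ', Equiv.Perm.mul_apply, ih, quarter_cornerEdge, Nat.cast_succ, add_assoc]

theorem dihedralAction_r_cornerEdge (i j : ZMod 4) :
    dihedralAction hm hn (.r i) (cornerEdge hm hn j) = cornerEdge hm hn (j + i) :=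
  (quarter_pow_cornerEdge hm hn i.val j).trans (by rw [ZMod.natCast_zmod_val])

theorem dihedralAction_sr_cornerEdge (i j : ZMod 4) :
    dihedralAction hm hn (.sr i) (cornerEdge hm hn j) = cornerEdge hm hn (1 - (j + i)) :=
  (congrArg _ (dihedralAction_r_cornerEdge hm hn i j)).trans (rotPerm_cornerEdge hm hn _)

theorem eq_one_of_fixes_cornerEdge {d : DihedralGroup 4}
    (h : ∀ j, dihedralAction hm hn d (cornerEdge hm hn j) = cornerEdge hm hn j) : d = 1 := by
  rcases d with i | i
  · have h0 := cornerEdge_injective hm hn ((dihedralAction_r_cornerEdge hm hn i 0).symm.trans (h 0))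
    rw [zero_add] at h0
    rw [h0, DihedralGroup.one_def]
  · have h0 := cornerEdge_injective hm hn
      ((dihedralAction_sr_cornerEdge hm hn i 0).symm.trans (h 0))
    have h1 := cornerEdge_injective hm hn
      ((dihedralAction_sr_cornerEdge hm hn i 1).symm.trans (h 1))
    clear h
    revert i
    decide

theorem dihedralAction_injective : Function.Injective (dihedralAction hm hn) :=
  (injective_iff_map_eq_one _).2 fun _ hd =>
    eq_one_of_fixes_cornerEdge hm hn fun _ => by rw [hd, Equiv.Perm.one_apply]

theorem apexSwap_notMem_range : apexSwap m n ∉ (dihedralAction hm hn).range := by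
  rintro ⟨d, hd⟩
  have hfix (j : ZMod 4) : apexSwap m n (cornerEdge hm hn j) = cornerEdge hm hn j := by
    fin_cases j <;> exact apexSwap_apply (by simp [cornerEdge]) (by simp [cornerEdge])
  obtain rfl := eq_one_of_fixes_cornerEdge hm hn (d := d) fun j => by rw [hd, hfix]
  have h := DFunLike.congr_fun hd ⟨bot, trivial⟩
  rw [map_one, apexSwap, Equiv.swap_apply_left] at h
  exact absurd (congrArg Subtype.val h) (by simp)

/-- The action on the edges of the dihedral group and the exchange of the unbounded edges. -/
def smallAction : DihedralGroup 4 × Multiplicative (ZMod 2) →* Equiv.Perm (Edges m n) :=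
  adjoinInvolution (dihedralAction hm hn) (apexSwap m n) apexSwap_sq
    (dihedralAction_commute hm hn rotPerm_commute_apexSwap (cornerSwap_commute_apexSwap hm hn))

theorem smallAction_injective : Function.Injective (smallAction hm hn) :=
  adjoinInvolution_injective _ _ (dihedralAction_injective hm hn) (apexSwap_notMem_range hm hn)

theorem smallAction_range_le {H : Subgroup (Equiv.Perm (Edges m n))} :
    (smallAction hm hn).range ≤ H ↔
      (rotPerm m n ∈ H ∧ cornerSwap hm hn ∈ H) ∧ apexSwap m n ∈ H := by
  rw [smallAction, adjoinInvolution_range, sup_le_iff, dihedralAction_range_le,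
    Subgroup.zpowers_le]

theorem smallAction_range_le_gridAut : (smallAction hm hn).range ≤ gridAut m n :=
  (smallAction_range_le hm hn).2 ⟨⟨rotPerm_mem, cornerSwap_mem hm hn⟩, apexSwap_mem⟩

theorem flipEquiv_one : (flipEquiv 1 1 : Equiv.Perm (Edges 1 1)) =
    cornerSwap one_pos one_pos * lastSwap one_pos one_pos * apexSwap 1 1 := by
  refine Equiv.ext ?_
  rintro ⟨_ | _ | ⟨i, k⟩ | ⟨i, k⟩, he⟩
  · rfl
  · rfl
  · obtain ⟨hi, hk⟩ := id he
    interval_cases i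
    interval_cases k <;> rfl
  · obtain ⟨hi, hk⟩ := id he
    interval_cases k
    interval_cases i <;> rfl

theorem gridAut_eq_smallAction_range (hmn : m = n → m = 1) :
    gridAut m n = (smallAction hm hn).range := by
  obtain ⟨⟨hr, hc⟩, ha⟩ := (smallAction_range_le hm hn).1 le_rfl
  refine le_antisymm (gridAut_le hm hn ha hr hc fun τ hτ => ?_)
    (smallAction_range_le_gridAut hm hn)
  have hvalid : Valid m n (hor (n - 1) m) :=
    (hτ ⟨ver m (n - 1), le_rfl, Nat.sub_lt hn one_pos⟩).subst (τ _).2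
  obtain rfl : m = n := by
    simp only [Valid] at hvalid
    omega
  obtain rfl := hmn rfl
  rw [show τ = flipEquiv 1 1 from Equiv.ext fun e => Subtype.ext (hτ e), flipEquiv_one,
    ← rotPerm_conj_cornerSwap]
  exact mul_mem (mul_mem hc (mul_mem (mul_mem hr hc) hr)) ha

end Structure

section Square

open scoped Pointwise

variable {m : ℕ} (hm : 0 < m)

theorem flipEquiv_sq : (flipEquiv m m : Equiv.Perm (Edges m m)) ^ 2 = 1 := by
  rw [sq]
  exact Equiv.ext fun e => Subtype.ext (GridEdge.flip_flip e.1)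

theorem rotPerm_commute_flipEquiv :
    Commute (rotPerm m m) (flipEquiv m m : Equiv.Perm (Edges m m)) :=
  Equiv.ext fun ⟨e, _⟩ => Subtype.ext (by cases e <;> rfl)

theorem smallAction_commute_flipEquiv (p : DihedralGroup 4 × Multiplicative (ZMod 2)) :
    Commute (smallAction hm hm p) (flipEquiv m m : Equiv.Perm (Edges m m)) := by
  have hc : Commute (flipEquiv m m : Equiv.Perm (Edges m m)) (cornerSwap hm hm) :=
    commute_swap_of_apply (.inr ⟨rfl, rfl⟩)
  have ha : Commute (flipEquiv m m : Equiv.Perm (Edges m m)) (apexSwap m m) :=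
    commute_swap_of_apply (.inr ⟨rfl, rfl⟩)
  exact (dihedralAction_commute hm hm rotPerm_commute_flipEquiv hc.symm p.1).mul_left
    (ha.symm.pow_left _)

theorem flipEquiv_notMem_range (hm₂ : 2 ≤ m) : flipEquiv m m ∉ (smallAction hm hm).range := by
  let S : Set (Edges m m) := {e | e.1 = hor 0 1 ∨ e.1 = hor (m - 1) (m - 1)}
  have hS : (smallAction hm hm).range ≤ MulAction.stabilizer (Equiv.Perm (Edges m m)) S := by
    simp only [smallAction_range_le, MulAction.mem_stabilizer_set, Equiv.Perm.smul_def]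
    refine ⟨⟨fun ⟨e, he⟩ => ?_, fun ⟨e, he⟩ => ?_⟩, fun ⟨e, he⟩ => ?_⟩
    · change (e.rot m m = _ ∨ e.rot m m = _) ↔ (e = _ ∨ e = _)
      cases e <;> simp only [GridEdge.rot, Valid, hor.injEq, reduceCtorEq] at he ⊢
      omega
    · simp only [S, cornerSwap, Equiv.swap_apply_def, Set.mem_ofPred_eq]
      grind
    · simp only [S, apexSwap, Equiv.swap_apply_def, Set.mem_ofPred_eq]
      grind
  intro h
  have := MulAction.mem_stabilizer_set.1 (hS h) ⟨ver 1 0, hm, hm⟩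
  simp [S, flipEquiv, GridEdge.flip] at this

/-- The action on the edges of a square grid, including the exchange of coordinates. -/
def squareAction :
    (DihedralGroup 4 × Multiplicative (ZMod 2)) × Multiplicative (ZMod 2) →*
      Equiv.Perm (Edges m m) :=
  adjoinInvolution (smallAction hm hm) (flipEquiv m m) flipEquiv_sq
    (smallAction_commute_flipEquiv hm)

theorem squareAction_injective (hm₂ : 2 ≤ m) : Function.Injective (squareAction hm) :=
  adjoinInvolution_injective _ _ (smallAction_injective hm hm) (flipEquiv_notMem_range hm hm₂)

theorem gridAut_eq_squareAction_range : gridAut m m = (squareAction hm).range := by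
  have hrange : (squareAction hm).range =
      (smallAction hm hm).range ⊔ Subgroup.zpowers (flipEquiv m m) := adjoinInvolution_range _ _ _ _
  rw [hrange]
  refine le_antisymm ?_
    (sup_le (smallAction_range_le_gridAut hm hm) (Subgroup.zpowers_le.2 flipEquiv_mem))
  obtain ⟨⟨hr, hc⟩, ha⟩ := (smallAction_range_le hm hm).1 le_sup_left
  refine gridAut_le hm hm ha hr hc fun τ hτ => ?_
  rw [show τ = flipEquiv m m from Equiv.ext fun e => Subtype.ext (hτ e)]
  exact Subgroup.mem_sup_right (Subgroup.mem_zpowers _)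

end Square

theorem nonempty_combAut_mulEquiv {m n : ℕ} {G : Type*} [Group G]
    {Φ : G →* Equiv.Perm (Edges m n)} (hΦ : Function.Injective Φ)
    (hrange : gridAut m n = Φ.range) :
    Nonempty (CombAut (GTPolytope (twoPartPartition (m + 1) (n + 1))) ≃* G) := by
  have e := combAutGTEquiv m n
  rw [← isHasseDiagram_grid.polyhedron_eq_orderPolytope] at e
  exact ⟨e.trans <|
    (MonoidHom.ofInjective isHasseDiagram_grid.isIrredundant.facetHom_injective).trans <|
      (MulEquiv.subgroupCongr hrange).trans (MonoidHom.ofInjective hΦ).symm⟩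

theorem theorem1p2 (a₁ a₂ : ℕ) (h₁ : 2 ≤ a₁) (h₂ : 2 ≤ a₂) :
    ((a₁ = 2 ∧ a₂ = 2) →
      Nonempty (CombAut (GTPolytope (twoPartPartition a₁ a₂)) ≃*
        DihedralGroup 4 × Multiplicative (ZMod 2))) ∧
    (¬ (a₁ = 2 ∧ a₂ = 2) →
      Nonempty (CombAut (GTPolytope (twoPartPartition a₁ a₂)) ≃*
        DihedralGroup 4 × Multiplicative (ZMod 2) ×
          (Fin (if a₁ = a₂ then 1 else 0) → Multiplicative (ZMod 2)))) := by
  obtain ⟨m, rfl⟩ : ∃ m, a₁ = m + 1 := ⟨a₁ - 1, by omega⟩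
  obtain ⟨n, rfl⟩ : ∃ n, a₂ = n + 1 := ⟨a₂ - 1, by omega⟩
  have hm : 0 < m := by omega
  have hn : 0 < n := by omega
  have small (h : m = n → m = 1) := nonempty_combAut_mulEquiv (smallAction_injective hm hn)
    (gridAut_eq_smallAction_range hm hn h)
  refine ⟨fun h => small (by omega), fun h => ?_⟩
  by_cases hmn : m = n
  · subst hmn
    rw [if_pos rfl]
    obtain ⟨φ⟩ := nonempty_combAut_mulEquiv (squareAction_injective hm (by omega))
      (gridAut_eq_squareAction_range hm)
    exact ⟨(φ.trans MulEquiv.prodAssoc).trans ((MulEquiv.refl _).prodCongr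
      ((MulEquiv.refl _).prodCongr (MulEquiv.funUnique (Fin 1) _).symm))⟩
  · rw [if_neg (by omega)]
    obtain ⟨φ⟩ := small fun h => absurd h hmn
    exact ⟨φ.trans ((MulEquiv.refl _).prodCongr MulEquiv.prodUnique.symm)⟩
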